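/- Let $\mathbb{Z}^2_{even}=\{(i,j)\in\mathbb{Z}^2 : i+j \text{ is even}\}$ and $\lambda>0$. The dynamical discrete web with switching rate $\lambda$ consists of independent càdlàg continuous-time Markov processes $(\xi^s_{i,j})_{s\ge 0}$, $(i,j)\in\mathbb{Z}^2_{even}$, with state space $\{-1,+1\}$, rate $\lambda/2$ for changing state in either direction, and $\mathbb{P}(\xi^0_{i,j}=+1)=\tfrac12$. For each dynamical time $s\ge 0$, let $S^s(n)$, $n=0,1,2,\dots$, be the path that starts at $S^s(0)=0$ and follows the arrows from $(i,j)$ to $(i+\xi^s_{i,j},\,j+1)$, i.e. $S^s(n+1)=S^s(n)+\xi^s_{S^s(n),\,n}$. For $\bar\lambda,\delta\in(0,\infty)$ let $S^s_{\delta,\bar\lambda}(t)=\sqrt{\delta}\,S^s([t/\delta])$ for real $t\ge 0$, where $[x]$ is the integer part of $x$ and $S^s$ is the path above for the switching rate $\lambda=\bar\lambda\sqrt{\delta}$. Let $p_{\delta,\bar\lambda}(K,\bar k)$ be the probability that there is at least one $s\in[0,1]$ such that $S^s_{\delta,\bar\lambda}(t)\ge -\bar k-K\sqrt{t}$ for all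 $t\ge 0$. Theorem (violation of the CLT). There exists a constant $K\in(0,\infty)$ such that the following hold. 1. For every $\bar k>0$ there exist $\bar\lambda_0,\lambda_0\in(0,\infty)$ such that $$\inf_{\bar\lambda\ge\bar\lambda_0,\ 0<\delta\le(\lambda_0/\bar\lambda_0)^2} p_{\delta,\bar\lambda}(K,\bar k)>0. \qquad (*)$$ 2. For all $\bar\lambda_0,\lambda_0\in(0,\infty)$ there exists $\bar k\in(0,\infty)$ such that $(*)$ holds. 3. For all $\delta,\bar\lambda\in(0,\infty)$, $p_{\delta,\bar\lambda}(K,0)>0$. -/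

import Mathlib

open MeasureTheory ProbabilityTheory Filter Topology
open scoped NNReal ENNReal

universe u

namespace DynWeb

/-- The even space-time sublattice: pairs (space, time) of integers whose sum is even. -/
abbrev Site : Type := {z : ℤ × ℤ // Even (z.1 + z.2)}

/-- The space-time origin. -/
def origin : Site := ⟨(0, 0), by simp⟩

/-- The arrow at `z = (i, j)` points to `(i + η z, j + 1)`. The group `ℤˣ = {1, -1}` serves as
the set of arrow directions. -/
def step (η : Site → ℤˣ) (z : Site) : Site :=
  ⟨(z.1.1 + (η z : ℤ), z.1.2 + 1), by
    obtain ⟨⟨i, j⟩, h⟩ := z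
    rcases Int.units_eq_one_or (η ⟨(i, j), h⟩) with h1 | h1 <;>
      simp only [h1, Units.val_one, Units.val_neg] <;> grind⟩

/-- Position, after `n` steps, of the path which starts at the origin and follows the arrows of
the configuration `η`. -/
def walk (η : Site → ℤˣ) (n : ℕ) : ℤ := ((step η)^[n] origin).1.1

/-- The generator of the two-state chain that flips from either state at rate `r`. -/
def flipGenerator (r : ℝ) : Matrix ℤˣ ℤˣ ℝ := fun a b => if a = b then -r else r

/-- `X` is a càdlàg continuous-time Markov process on the two-point space `{1, -1}` that changes
state, in either direction, at rate `r`: its transition function is `exp (t Q)`, where `Q` is the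
flip generator. No initial law is prescribed. -/
structure IsFlipProcess {Ω : Type u} [MeasurableSpace Ω] (P : Measure Ω) (r : ℝ)
    (X : ℝ≥0 → Ω → ℤˣ) : Prop where
  measurable : ∀ s, Measurable (X s)
  right_continuous : ∀ ω s, ContinuousWithinAt (fun u => X u ω) (Set.Ici s) s
  left_limit : ∀ ω s, ∃ a, Tendsto (fun u => X u ω) (𝓝[<] s) (𝓝 a)
  markov : ∀ (n : ℕ) (s : ℕ → ℝ≥0) (a : ℕ → ℤˣ), Monotone s →
    P.real {ω | ∀ i ≤ n + 1, X (s i) ω = a i} =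
      P.real {ω | ∀ i ≤ n, X (s i) ω = a i} *
        NormedSpace.exp (((s (n + 1) : ℝ) - (s n : ℝ)) • flipGenerator r) (a n) (a (n + 1))

/-- `ξ z s ω` (site `z`, dynamical time `s`) is a family of arrows of a dynamical discrete web
with switching rate `lam`: independent càdlàg Markov processes on `{1, -1}` which change state at
rate `lam / 2` in either direction and start from symmetric Bernoulli variables. -/
structure IsDynamicalWeb {Ω : Type u} [MeasurableSpace Ω] (P : Measure Ω) (lam : ℝ)
    (ξ : Site → ℝ≥0 → Ω → ℤˣ) : Prop where
  flip : ∀ z, IsFlipProcess P (lam / 2) (ξ z)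
  initial : ∀ z, P.real {ω | ξ z 0 ω = 1} = 1 / 2
  independent : iIndepFun (fun z ω s => ξ z s ω) P

/-- `S^s(n)`: position at time `n` of the path from the origin in the web at dynamical time `s`. -/
def pathAt {Ω : Type u} (ξ : Site → ℝ≥0 → Ω → ℤˣ) (ω : Ω) (s : ℝ≥0) (n : ℕ) : ℤ :=
  walk (fun z => ξ z s ω) n

/-- The diffusively rescaled path `√δ * S^s([t / δ])`. -/
noncomputable def rescaledPath {Ω : Type u} (ξ : Site → ℝ≥0 → Ω → ℤˣ) (δ : ℝ) (ω : Ω) (s : ℝ≥0)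
    (t : ℝ) : ℝ :=
  √δ * (pathAt ξ ω s ⌊t / δ⌋₊ : ℝ)

/-- The exceptional dynamical times in `[0, 1]`, at which the rescaled path from the origin stays
at or above `-k - K √t` for ever. -/
def exceptionalTimes {Ω : Type u} (ξ : Site → ℝ≥0 → Ω → ℤˣ) (δ K k : ℝ) (ω : Ω) : Set ℝ≥0 :=
  {s | s ∈ Set.Icc 0 1 ∧ ∀ t : ℝ, 0 ≤ t → -k - K * √t ≤ rescaledPath ξ δ ω s t}

/-- The probability that the set of exceptional dynamical times in `[0, 1]` is nonempty. -/
noncomputable def exceptionalProb {Ω : Type u} [MeasurableSpace Ω] (P : Measure Ω)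
    (ξ : Site → ℝ≥0 → Ω → ℤˣ) (δ K k : ℝ) : ℝ≥0∞ :=
  P {ω | (exceptionalTimes ξ δ K k ω).Nonempty}

/-- The probabilities of exceptional times, for switching rates `lbar * √δ`, are bounded below by
one positive constant over all `lbar ≥ lbar0` and all `0 < δ ≤ (lam0 / lbar0) ^ 2`, in every
realization of the dynamical discrete web. -/
def UniformlyPositive (K k lbar0 lam0 : ℝ) : Prop :=
  ∃ c : ℝ≥0∞, 0 < c ∧
    ∀ lbar δ : ℝ, lbar0 ≤ lbar → 0 < δ → δ ≤ (lam0 / lbar0) ^ 2 →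
      ∀ (Ω : Type u) [MeasurableSpace Ω] (P : Measure Ω) [IsProbabilityMeasure P]
        (ξ : Site → ℝ≥0 → Ω → ℤˣ),
        IsDynamicalWeb P (lbar * √δ) ξ → c ≤ exceptionalProb P ξ δ K k

end DynWeb

namespace DynWeb

/-- The endpoint of the arrow at `z` with direction `e`. -/
def move (z : Site) (e : ℤˣ) : Site := step (fun _ => e) z

lemma step_eq_move (η : Site → ℤˣ) (z : Site) : step η z = move z (η z) := rfl

@[simp] lemma move_fst (z : Site) (e : ℤˣ) : (move z e).1.1 = z.1.1 + e := rfl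

@[simp] lemma move_snd (z : Site) (e : ℤˣ) : (move z e).1.2 = z.1.2 + 1 := rfl

lemma iterate_step_snd (η : Site → ℤˣ) (z : Site) (n : ℕ) :
    ((step η)^[n] z).1.2 = z.1.2 + n := by
  induction n generalizing z with
  | zero => simp
  | succ n ih =>
    rw [Function.iterate_succ_apply, ih, step_eq_move, move_snd]; push_cast; ring

/-- Two sites of one row whose positions agree are equal. -/
lemma site_ext {z z' : Site} (hr : z.1.2 = z'.1.2) (h : z.1.1 = z'.1.1) : z = z' :=
  Subtype.ext (Prod.ext h hr)

lemma even_sub_of_row_eq {z z' : Site} (hr : z.1.2 = z'.1.2) : Even (z.1.1 - z'.1.1) := by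
  have h1 := z.2
  have h2 := z'.2
  rw [hr] at h1
  have := h1.sub h2
  rwa [add_sub_add_right_eq_sub] at this

/-- Paths of one web do not cross: one step. -/
lemma step_mono (η : Site → ℤˣ) {z z' : Site} (hr : z.1.2 = z'.1.2) (h : z.1.1 ≤ z'.1.1) :
    (step η z).1.1 ≤ (step η z').1.1 := by
  rcases h.eq_or_lt with h | h
  · rw [site_ext hr h]
  · obtain ⟨c, hc⟩ := even_sub_of_row_eq hr
    simp only [step_eq_move, move_fst]
    rcases Int.units_eq_one_or (η z) with h1 | h1 <;>
      rcases Int.units_eq_one_or (η z') with h2 | h2 <;> rw [h1, h2] <;> push_cast <;> omega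

/-- Paths of one web do not cross. -/
lemma iterate_step_mono (η : Site → ℤˣ) {z z' : Site} (hr : z.1.2 = z'.1.2)
    (h : z.1.1 ≤ z'.1.1) (n : ℕ) : ((step η)^[n] z).1.1 ≤ ((step η)^[n] z').1.1 := by
  induction n generalizing z z' with
  | zero => simpa
  | succ n ih =>
    simp only [Function.iterate_succ_apply]
    refine ih ?_ (step_mono η hr h)
    simp [step_eq_move, hr]

/-- The value `φ (min m M)`, where `M` is the minimum of the path of `η` from `z` over the
steps `1, …, n`. -/
def minValue (φ : ℤ → ℝ) : ℕ → Site → ℤ → (Site → ℤˣ) → ℝ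
  | 0, _, m, _ => φ m
  | n + 1, z, m, η => minValue φ n (move z (η z)) (min m (move z (η z)).1.1) η

/-- The sites whose arrows may be used by the first `n` steps of a path from `z`. -/
def reach : ℕ → Site → Finset Site
  | 0, _ => ∅
  | n + 1, z => insert z (reach n (move z 1) ∪ reach n (move z (-1)))

lemma reach_row {n : ℕ} {z w : Site} (h : w ∈ reach n z) :
    z.1.2 ≤ w.1.2 ∧ w.1.2 < z.1.2 + n := by
  induction n generalizing z with
  | zero => simp [reach] at h
  | succ n ih =>
    simp only [reach, Finset.mem_insert, Finset.mem_union] at h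
    rcases h with h | h | h
    · subst h; push_cast; omega
    · have := ih h; rw [move_snd] at this; push_cast; omega
    · have := ih h; rw [move_snd] at this; push_cast; omega

lemma minValue_congr (φ : ℤ → ℝ) {n : ℕ} {z : Site} {m : ℤ} {η η' : Site → ℤˣ}
    (h : ∀ w ∈ reach n z, η w = η' w) : minValue φ n z m η = minValue φ n z m η' := by
  induction n generalizing z m with
  | zero => rfl
  | succ n ih =>
    have hz : η z = η' z := h z (by simp [reach])
    simp only [minValue, ← hz]
    refine ih fun w hw => h w ?_
    rcases Int.units_eq_one_or (η z) with h1 | h1 <;> rw [h1] at hw <;> simp [reach, hw]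

lemma minValue_mem {φ : ℤ → ℝ} (hφ : ∀ m, φ m ∈ Set.Icc (0 : ℝ) 1) (n : ℕ) (z : Site) (m : ℤ)
    (η : Site → ℤˣ) : minValue φ n z m η ∈ Set.Icc (0 : ℝ) 1 := by
  induction n generalizing z m with
  | zero => exact hφ m
  | succ n ih => exact ih _ _

lemma le_of_minValue_pos {φ : ℤ → ℝ} {B : ℤ} (hφ : ∀ m, 0 < φ m → B ≤ m) {n : ℕ} {z : Site}
    {m : ℤ} {η : Site → ℤˣ} (h : 0 < minValue φ n z m η) :
    B ≤ m ∧ ∀ j < n, B ≤ ((step η)^[j + 1] z).1.1 := by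
  induction n generalizing z m with
  | zero => exact ⟨hφ m h, by simp⟩
  | succ n ih =>
    obtain ⟨h1, h2⟩ := ih h
    refine ⟨h1.trans (min_le_left _ _), fun j hj => ?_⟩
    rw [Function.iterate_succ_apply, step_eq_move]
    cases j with
    | zero => exact h1.trans (min_le_right _ _)
    | succ j => exact h2 j (by omega)

/-- The mean of `minValue φ n z m` under independent symmetric arrows, as a function of the
position `x` of `z`. -/
noncomputable def meanMin (φ : ℤ → ℝ) : ℕ → ℤ → ℤ → ℝ
  | 0, _, m => φ m
  | n + 1, x, m =>
    (meanMin φ n (x + 1) (min m (x + 1)) + meanMin φ n (x - 1) (min m (x - 1))) / 2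

lemma meanMin_mem {φ : ℤ → ℝ} (hφ : ∀ m, φ m ∈ Set.Icc (0 : ℝ) 1) (n : ℕ) (x m : ℤ) :
    meanMin φ n x m ∈ Set.Icc (0 : ℝ) 1 := by
  induction n generalizing x m with
  | zero => exact hφ m
  | succ n ih =>
    have h1 := ih (x + 1) (min m (x + 1))
    have h2 := ih (x - 1) (min m (x - 1))
    simp only [Set.mem_Icc, meanMin] at *
    constructor <;> linarith [h1.1, h1.2, h2.1, h2.2]

lemma abs_meanMin_sub_le {φ : ℤ → ℝ} {L : ℝ} (hφ : ∀ m m', |φ m - φ m'| ≤ L * |(m - m' : ℤ)|)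
    (hL : 0 ≤ L) (n : ℕ) {x y m m' d : ℤ} (hx : |x - y| ≤ d) (hm : |m - m'| ≤ d) :
    |meanMin φ n x m - meanMin φ n y m'| ≤ L * d := by
  induction n generalizing x y m m' with
  | zero => exact (hφ m m').trans (mul_le_mul_of_nonneg_left (by exact_mod_cast hm) hL)
  | succ n ih =>
    have key : ∀ e : ℤ, |min m (x + e) - min m' (y + e)| ≤ d := fun e =>
      (abs_min_sub_min_le_max _ _ _ _).trans (max_le hm (by simpa using hx))
    have h1 := ih (x := x + 1) (y := y + 1) (by simpa using hx) (key 1)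
    have h2 := ih (x := x + -1) (y := y + -1) (by simpa using hx) (key (-1))
    simp only [meanMin, sub_eq_add_neg x 1, sub_eq_add_neg y 1]
    rw [abs_le] at *
    constructor <;> linarith [h1.1, h1.2, h2.1, h2.2]

/-- Kolmogorov's inequality for the minimum of the simple random walk. -/
lemma one_sub_le_meanMin {φ : ℤ → ℝ} (hφ : ∀ m, φ m ∈ Set.Icc (0 : ℝ) 1) {b : ℝ} (hb : 0 < b)
    {x₀ : ℤ} (h1 : ∀ m : ℤ, (x₀ : ℝ) - b ≤ m → φ m = 1) (n : ℕ) (x m : ℤ)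
    (hm : (x₀ : ℝ) - b ≤ m) : 1 - ((x - x₀ : ℝ) ^ 2 + n) / b ^ 2 ≤ meanMin φ n x m := by
  induction n generalizing x m with
  | zero =>
    simp only [meanMin, h1 m hm]
    have : 0 ≤ ((x - x₀ : ℝ) ^ 2 + (0 : ℕ)) / b ^ 2 := by positivity
    linarith
  | succ n ih =>
    have key : ∀ y : ℤ, 1 - ((y - x₀ : ℝ) ^ 2 + n) / b ^ 2 ≤ meanMin φ n y (min m y) := by
      intro y
      by_cases hy : (x₀ : ℝ) - b ≤ y
      · exact ih y _ (by push_cast; exact le_min hm hy)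
      · refine le_trans ?_ (meanMin_mem hφ n y _).1
        rw [sub_nonpos, le_div_iff₀ (by positivity)]
        push Not at hy
        nlinarith [(Nat.cast_nonneg n : (0 : ℝ) ≤ n)]
    have h2 := key (x + 1)
    have h3 := key (x - 1)
    simp only [meanMin]
    push_cast at *
    have : ((x - x₀ : ℝ) ^ 2 + (n + 1)) / b ^ 2 =
        (((x + 1 - x₀ : ℝ) ^ 2 + n) / b ^ 2 + ((x - 1 - x₀ : ℝ) ^ 2 + n) / b ^ 2) / 2 := by
      ring
    linarith

lemma units_ne_iff (a b : ℤˣ) : a ≠ b ↔ a = -b := by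
  rcases Int.units_eq_one_or a with h | h <;> rcases Int.units_eq_one_or b with h' | h' <;>
    subst h <;> subst h' <;> decide

lemma sum_units (f : ℤˣ → ℝ) : ∑ a, f a = f 1 + f (-1) := by
  rw [UnitsInt.univ, Finset.sum_pair (by decide)]

instance : MeasurableSingletonClass ℤˣ :=
  ⟨fun a => ⟨{(a : ℤ)}, MeasurableSet.singleton _, by ext b; simp [Units.ext_iff]⟩⟩

/-- The transition function of the symmetric two-state chain. -/
lemma exp_flipGenerator (r t : ℝ) (a b : ℤˣ) :
    NormedSpace.exp (t • flipGenerator r) a b =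
      (1 + ((a * b : ℤˣ) : ℤ) * Real.exp (-(2 * r * t))) / 2 := by
  obtain ⟨U, hU'⟩ : ∃ U : Matrix ℤˣ ℤˣ ℝ, ∀ a b, U a b = if a = 1 ∨ b = 1 then 1 else -1 :=
    ⟨fun a b => if a = 1 ∨ b = 1 then 1 else -1, fun _ _ => rfl⟩
  obtain ⟨D, hD'⟩ : ∃ D : ℤˣ → ℝ, ∀ a, D a = if a = 1 then 0 else -(2 * r * t) :=
    ⟨fun a => if a = 1 then 0 else -(2 * r * t), fun _ => rfl⟩
  have hUU : U * ((1 / 2 : ℝ) • U) = 1 := by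
    ext a b
    rw [Matrix.mul_apply, sum_units]
    rcases Int.units_eq_one_or a with h | h <;> rcases Int.units_eq_one_or b with h' | h' <;>
      subst h <;> subst h' <;> simp [hU', Matrix.smul_apply] <;> norm_num
  have hU : IsUnit U := .of_mul_eq_one _ hUU
  have hinv : U⁻¹ = (1 / 2 : ℝ) • U := Matrix.inv_eq_right_inv hUU
  have hQ : t • flipGenerator r = U * Matrix.diagonal D * U⁻¹ := by
    ext a b
    rw [hinv, Matrix.mul_apply, sum_units]
    rcases Int.units_eq_one_or a with h | h <;> rcases Int.units_eq_one_or b with h' | h' <;>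
      subst h <;> subst h' <;>
      simp [hU', hD', flipGenerator, Matrix.smul_apply, Matrix.mul_diagonal] <;> ring
  rw [hQ, Matrix.exp_conj _ _ hU, Matrix.exp_diagonal, hinv, Matrix.mul_apply, sum_units]
  have hD : ∀ a, NormedSpace.exp D a = Real.exp (D a) := fun a => by
    rw [Pi.coe_exp, Real.exp_eq_exp_ℝ]
  rcases Int.units_eq_one_or a with h | h <;> rcases Int.units_eq_one_or b with h' | h' <;>
    subst h <;> subst h' <;> simp [hU', hD', Matrix.smul_apply, Matrix.mul_diagonal, hD] <;> ring

section flip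

variable {Ω : Type u} [MeasurableSpace Ω] {P : Measure Ω} {r : ℝ} {X : ℝ≥0 → Ω → ℤˣ}

lemma IsFlipProcess.measurableSet_eq (h : IsFlipProcess P r X) (s : ℝ≥0) (a : ℤˣ) :
    MeasurableSet {ω | X s ω = a} := h.measurable s (measurableSet_singleton a)

lemma IsFlipProcess.real_two (h : IsFlipProcess P r X) {u v : ℝ≥0} (huv : u ≤ v) (a b : ℤˣ) :
    P.real {ω | X u ω = a ∧ X v ω = b} = P.real {ω | X u ω = a} *
      ((1 + ((a * b : ℤˣ) : ℤ) * Real.exp (-(2 * r * (v - u)))) / 2) := by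
  have hs : Monotone (fun i : ℕ => if i = 0 then u else v) := by
    refine monotone_nat_of_le_succ fun n => ?_
    by_cases hn : n = 0 <;> simp [hn, huv]
  have := h.markov 0 _ (fun i => if i = 0 then a else b) hs
  rw [exp_flipGenerator] at this
  simpa [Nat.le_one_iff_eq_zero_or_eq_one, or_imp, forall_and] using this

lemma IsFlipProcess.real_add [IsProbabilityMeasure P] (h : IsFlipProcess P r X) (s : ℝ≥0) {A : Set Ω} :
    P.real A = P.real {ω | X s ω = 1 ∧ ω ∈ A} + P.real {ω | X s ω = -1 ∧ ω ∈ A} := by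
  rw [← measureReal_inter_add_sdiff (s := A) (h.measurableSet_eq s 1)]
  congr 2
  · ext ω; simp [and_comm]
  · ext ω
    simp only [Set.mem_sdiff, Set.mem_ofPred_eq, and_comm, ← ne_eq, units_ne_iff]

lemma IsFlipProcess.real_eq_half [IsProbabilityMeasure P] (h : IsFlipProcess P r X)
    (h0 : P.real {ω | X 0 ω = 1} = 1 / 2) (s : ℝ≥0) (a : ℤˣ) :
    P.real {ω | X s ω = a} = 1 / 2 := by
  have h1 : P.real {ω | X 0 ω = -1} = 1 / 2 := by
    have := h.real_add 0 (A := Set.univ)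
    simp only [Set.mem_univ, and_true, h0, probReal_univ] at this
    linarith
  rw [h.real_add 0 (A := {ω | X s ω = a})]
  simp only [Set.mem_ofPred_eq]
  rw [h.real_two (zero_le), h.real_two (zero_le), h0, h1]
  rcases Int.units_eq_one_or a with h | h <;> subst h <;> norm_num <;> ring

lemma IsFlipProcess.real_ne_le [IsProbabilityMeasure P] (h : IsFlipProcess P r X)
    (h0 : P.real {ω | X 0 ω = 1} = 1 / 2) {u v : ℝ≥0} (huv : u ≤ v) :
    P.real {ω | X u ω ≠ X v ω} ≤ r * (v - u) := by
  rw [h.real_add u]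
  have e : ∀ a : ℤˣ, {ω | X u ω = a ∧ ω ∈ {ω | X u ω ≠ X v ω}} =
      {ω | X u ω = a ∧ X v ω = -a} := fun a => by
    ext ω
    simp only [Set.mem_ofPred_eq]
    refine and_congr_right fun hu => ?_
    rw [hu, ne_comm, units_ne_iff]
  rw [e, e, h.real_two huv, h.real_two huv, h.real_eq_half h0, h.real_eq_half h0]
  have := Real.add_one_le_exp (-(2 * r * ((v : ℝ) - u)))
  norm_num
  linarith

/-- The `j`-th point of the dyadic partition of generation `m` of `[a, a + l]`. -/
noncomputable def dyadicPoint (a l : ℝ≥0) (m j : ℕ) : ℝ≥0 := a + l * (j / 2 ^ m)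

/-- The event that `X` changes along some dyadic partition of `[a, a + l]`. -/
def flipsIn {Ω : Type u} (X : ℝ≥0 → Ω → ℤˣ) (a l : ℝ≥0) : Set Ω :=
  ⋃ m : ℕ, ⋃ j ∈ Finset.range (2 ^ m), {ω | X (dyadicPoint a l m j) ω ≠ X (dyadicPoint a l m (j + 1)) ω}

lemma dyadicPoint_succ (a l : ℝ≥0) (m j : ℕ) :
    dyadicPoint a l (m + 1) (2 * j) = dyadicPoint a l m j := by
  simp only [dyadicPoint]; congr 2; push_cast; rw [pow_succ']; field_simp

lemma IsFlipProcess.real_flipsIn_le [IsProbabilityMeasure P] (h : IsFlipProcess P r X)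
    (h0 : P.real {ω | X 0 ω = 1} = 1 / 2) (a l : ℝ≥0) : P (flipsIn X a l) ≤ ENNReal.ofReal (r * l) := by
  rw [flipsIn, Monotone.measure_iUnion]
  · refine iSup_le fun m => ?_
    rw [← ofReal_measureReal (measure_ne_top _ _)]
    refine ENNReal.ofReal_le_ofReal ?_
    refine (measureReal_biUnion_finset_le _ _).trans ?_
    have : ∀ j ∈ Finset.range (2 ^ m), P.real {ω | X (dyadicPoint a l m j) ω ≠
        X (dyadicPoint a l m (j + 1)) ω} ≤ r * l / 2 ^ m := fun j _ => by
      refine (h.real_ne_le h0 ?_).trans_eq ?_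
      · simp only [dyadicPoint]; gcongr; omega
      · simp only [dyadicPoint]; push_cast; ring
    refine (Finset.sum_le_sum this).trans_eq ?_
    simp only [Finset.sum_const, Finset.card_range, nsmul_eq_mul]; push_cast; field_simp
  · refine monotone_nat_of_le_succ fun m => ?_
    intro ω hω
    simp only [Set.mem_iUnion, Finset.mem_range, Set.mem_ofPred_eq, exists_prop] at hω ⊢
    obtain ⟨j, hj, hne⟩ := hω
    rw [← dyadicPoint_succ, ← dyadicPoint_succ a l m (j + 1)] at hne
    by_contra! hcon
    have e1 := hcon (2 * j) (by rw [pow_succ]; omega)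
    have e2 := hcon (2 * j + 1) (by rw [pow_succ]; omega)
    exact hne (e1.trans e2)

lemma IsFlipProcess.eq_of_notMem_flipsIn (h : IsFlipProcess P r X) {a l : ℝ≥0} {ω : Ω}
    (hω : ω ∉ flipsIn X a l) {s : ℝ≥0} (hs : a ≤ s) (hs' : s < a + l) : X s ω = X a ω := by
  have hl : 0 < l := by
    by_contra! hl
    rw [nonpos_iff_eq_zero.1 hl, add_zero] at hs'
    exact hs'.not_ge hs
  simp only [flipsIn, Set.mem_iUnion, Finset.mem_range, Set.mem_ofPred_eq, exists_prop, not_exists,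
    not_and, not_not] at hω
  have hgrid : ∀ m j : ℕ, j ≤ 2 ^ m → X (dyadicPoint a l m j) ω = X a ω := by
    intro m j
    induction j with
    | zero => simp [dyadicPoint]
    | succ j ih => intro hj; rw [← hω m j (by omega)]; exact ih (by omega)
  have hev : ∀ᶠ u in 𝓝[≥] s, X u ω = X s ω :=
    h.right_continuous ω s (by simp : {X s ω} ∈ 𝓝 (X s ω))
  obtain ⟨v, hsv, hv⟩ := (mem_nhdsGE_iff_exists_Ico_subset' (lt_add_of_pos_right s hl)).1 hev
  set w : ℝ≥0 := min v (a + l) with hw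
  have hsw : s < w := lt_min hsv hs'
  obtain ⟨m, hm⟩ : ∃ m : ℕ, (l : ℝ) / 2 ^ m < w - s := by
    have : Tendsto (fun m : ℕ => (l : ℝ) * (1 / 2) ^ m) atTop (𝓝 (l * 0)) :=
      (tendsto_pow_atTop_nhds_zero_of_lt_one (by norm_num) (by norm_num)).const_mul _
    rw [mul_zero] at this
    obtain ⟨m, hm⟩ := (this.eventually_lt_const (sub_pos.2 (NNReal.coe_lt_coe.2 hsw))).exists
    exact ⟨m, by simpa [div_eq_mul_inv] using hm⟩
  set x : ℝ := (s - a) / l * 2 ^ m with hx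
  have hlR : (0 : ℝ) < l := hl
  have hsx : (s : ℝ) = a + l * (x / 2 ^ m) := by rw [hx]; field_simp; ring
  have hx0 : 0 ≤ x := by
    have : (a : ℝ) ≤ s := hs
    have : 0 ≤ (s : ℝ) - a := by linarith
    positivity
  have h1 : s ≤ dyadicPoint a l m ⌈x⌉₊ := by
    rw [← NNReal.coe_le_coe, hsx]; simp only [dyadicPoint]; push_cast
    gcongr; exact Nat.le_ceil x
  have h2 : dyadicPoint a l m ⌈x⌉₊ < w := by
    rw [← NNReal.coe_lt_coe]; simp only [dyadicPoint]; push_cast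
    calc (a : ℝ) + l * (⌈x⌉₊ / 2 ^ m) ≤ a + l * ((x + 1) / 2 ^ m) := by
          gcongr; exact (Nat.ceil_lt_add_one hx0).le
      _ = s + l / 2 ^ m := by rw [hsx]; ring
      _ < w := by linarith
  have h3 : ⌈x⌉₊ ≤ 2 ^ m := by
    have h3 : dyadicPoint a l m ⌈x⌉₊ < a + l := h2.trans_le (min_le_right _ _)
    rw [← NNReal.coe_lt_coe] at h3
    simp only [dyadicPoint] at h3; push_cast at h3
    have h4 : (⌈x⌉₊ : ℝ) / 2 ^ m < 1 := by
      by_contra! hc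
      nlinarith
    rw [div_lt_one (by positivity)] at h4
    exact_mod_cast h4.le
  rw [← hgrid m _ h3]
  exact (hv ⟨h1, h2.trans_le (min_le_left _ _)⟩).symm

end flip

section rows

variable {Ω : Type u} {ξ : Site → ℝ≥0 → Ω → ℤˣ}

/-- The σ-algebra generated by the arrow processes at the sites whose rows lie in `J`. -/
abbrev rowAlgebra {Ω : Type u} (ξ : Site → ℝ≥0 → Ω → ℤˣ) (J : Set ℤ) : MeasurableSpace Ω :=
  ⨆ z ∈ {z : Site | z.1.2 ∈ J}, MeasurableSpace.comap (fun ω s => ξ z s ω) MeasurableSpace.pi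

lemma rowAlgebra_mono {J J' : Set ℤ} (h : J ⊆ J') : rowAlgebra ξ J ≤ rowAlgebra ξ J' :=
  biSup_mono fun _ hz => h hz

lemma measurable_arrow {J : Set ℤ} {z : Site} (hz : z.1.2 ∈ J) (s : ℝ≥0) :
    Measurable[rowAlgebra ξ J] (ξ z s) := by
  have h1 : Measurable[MeasurableSpace.comap (fun ω s => ξ z s ω) MeasurableSpace.pi] (ξ z s) :=
    (measurable_pi_apply s).comp (comap_measurable (fun ω s => ξ z s ω))
  exact h1.mono (le_iSup₂ (f := fun (z : Site) (_ : z ∈ {z : Site | z.1.2 ∈ J}) =>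
    MeasurableSpace.comap (fun ω s => ξ z s ω) MeasurableSpace.pi) z hz) le_rfl

lemma measurableSet_arrow {J : Set ℤ} {z : Site} (hz : z.1.2 ∈ J) (s : ℝ≥0) (a : ℤˣ) :
    MeasurableSet[rowAlgebra ξ J] {ω | ξ z s ω = a} :=
  measurable_arrow hz s (measurableSet_singleton a)

lemma minValue_succ_eq_ite (φ : ℤ → ℝ) (n : ℕ) (z : Site) (m : ℤ) (η : Site → ℤˣ) :
    minValue φ (n + 1) z m η =
      if η z = 1 then minValue φ n (move z 1) (min m (move z 1).1.1) η
      else minValue φ n (move z (-1)) (min m (move z (-1)).1.1) η := by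
  rcases Int.units_eq_one_or (η z) with h | h <;> simp [minValue, h]

lemma measurable_minValue (φ : ℤ → ℝ) (n : ℕ) (z : Site) (m : ℤ) (s : ℝ≥0) :
    Measurable[rowAlgebra ξ (Set.Ico z.1.2 (z.1.2 + n))]
      (fun ω => minValue φ n z m (fun w => ξ w s ω)) := by
  induction n generalizing z m with
  | zero => exact measurable_const
  | succ n ih =>
    simp only [minValue_succ_eq_ite]
    refine Measurable.ite (measurableSet_arrow (by simp) s 1) ?_ ?_
    all_goals
      refine (ih _ _).mono (rowAlgebra_mono ?_) le_rfl
      rw [move_snd]; push_cast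
      exact Set.Ico_subset_Ico (by omega) (by omega)

end rows

lemma integral_mul_of_indep {Ω : Type u} {m₁ m₂ mΩ : MeasurableSpace Ω} {P : Measure Ω}
    (hm₁ : m₁ ≤ mΩ) (hm₂ : m₂ ≤ mΩ) (h : Indep m₁ m₂ P)
    {f g : Ω → ℝ} (hf : Measurable[m₁] f) (hg : Measurable[m₂] g) :
    ∫ ω, f ω * g ω ∂P = (∫ ω, f ω ∂P) * ∫ ω, g ω ∂P := by
  have hfg : IndepFun f g P := by
    rw [IndepFun_iff_Indep]
    exact indep_of_indep_of_le_left (indep_of_indep_of_le_right h hg.comap_le) hf.comap_le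
  exact hfg.integral_fun_mul_eq_mul_integral (hf.mono hm₁ le_rfl).aestronglyMeasurable
    (hg.mono hm₂ le_rfl).aestronglyMeasurable

section moments

variable {Ω : Type u} [MeasurableSpace Ω] {P : Measure Ω} {lam : ℝ} {ξ : Site → ℝ≥0 → Ω → ℤˣ}

lemma IsDynamicalWeb.measurable_process (hξ : IsDynamicalWeb P lam ξ) (z : Site) :
    Measurable (fun ω s => ξ z s ω) :=
  measurable_pi_lambda _ fun s => (hξ.flip z).measurable s

lemma IsDynamicalWeb.rowAlgebra_le (hξ : IsDynamicalWeb P lam ξ) (J : Set ℤ) :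
    rowAlgebra ξ J ≤ ‹MeasurableSpace Ω› :=
  iSup₂_le fun z _ => (hξ.measurable_process z).comap_le

lemma IsDynamicalWeb.indep_rowAlgebra (hξ : IsDynamicalWeb P lam ξ) {J J' : Set ℤ}
    (h : Disjoint J J') : Indep (rowAlgebra ξ J) (rowAlgebra ξ J') P :=
  indep_iSup_of_disjoint (fun z => (hξ.measurable_process z).comap_le) hξ.independent
    (Set.disjoint_left.2 fun _ hz hz' => Set.disjoint_left.1 h hz hz')

lemma integrable_of_mem_Icc [IsFiniteMeasure P] {f : Ω → ℝ} (hf : Measurable f)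
    (h : ∀ ω, f ω ∈ Set.Icc (0 : ℝ) 1) : Integrable f P :=
  Integrable.of_bound hf.aestronglyMeasurable 1
    (.of_forall fun ω => by rw [Real.norm_eq_abs, abs_of_nonneg (h ω).1]; exact (h ω).2)

lemma mul_mem_Icc {x y : ℝ} (hx : x ∈ Set.Icc (0 : ℝ) 1) (hy : y ∈ Set.Icc (0 : ℝ) 1) :
    x * y ∈ Set.Icc (0 : ℝ) 1 :=
  ⟨mul_nonneg hx.1 hy.1, mul_le_one₀ hx.2 hy.1 hy.2⟩

variable [IsProbabilityMeasure P]

/-- The Markov property of a pair of paths at two dynamical times. -/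
lemma IsDynamicalWeb.integral_minValue_mul_succ (hξ : IsDynamicalWeb P lam ξ) {φ : ℤ → ℝ}
    (hφ : ∀ m, φ m ∈ Set.Icc (0 : ℝ) 1) (n : ℕ) {z z' : Site} (hr : z.1.2 = z'.1.2)
    (m m' : ℤ) (s s' : ℝ≥0) :
    ∫ ω, minValue φ (n + 1) z m (fun w => ξ w s ω) *
        minValue φ (n + 1) z' m' (fun w => ξ w s' ω) ∂P =
      ∑ a, ∑ b, P.real {ω | ξ z s ω = a ∧ ξ z' s' ω = b} *
        ∫ ω, minValue φ n (move z a) (min m (z.1.1 + (a : ℤ))) (fun w => ξ w s ω) *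
          minValue φ n (move z' b) (min m' (z'.1.1 + (b : ℤ))) (fun w => ξ w s' ω) ∂P := by
  have hms : ∀ a b, MeasurableSet[rowAlgebra ξ {z.1.2}] {ω | ξ z s ω = a ∧ ξ z' s' ω = b} :=
    fun a b => (measurableSet_arrow (by simp) s a).inter (measurableSet_arrow (by simp [hr]) s' b)
  have hpt : ∀ ω, minValue φ (n + 1) z m (fun w => ξ w s ω) *
        minValue φ (n + 1) z' m' (fun w => ξ w s' ω) =
      ∑ a, ∑ b, Set.indicator {ω | ξ z s ω = a ∧ ξ z' s' ω = b} (fun _ => (1 : ℝ)) ω *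
        (minValue φ n (move z a) (min m (z.1.1 + (a : ℤ))) (fun w => ξ w s ω) *
          minValue φ n (move z' b) (min m' (z'.1.1 + (b : ℤ))) (fun w => ξ w s' ω)) := by
    intro ω
    rw [Finset.sum_eq_single (ξ z s ω), Finset.sum_eq_single (ξ z' s' ω)]
    · simp [minValue, Set.indicator]
    · intro b _ hb; simp [Set.indicator, hb.symm]
    · exact fun h => (h (Finset.mem_univ _)).elim
    · intro a _ ha; simp [Set.indicator, ha.symm]
    · exact fun h => (h (Finset.mem_univ _)).elim
  have hmeas : ∀ a b : ℤˣ, Measurable[rowAlgebra ξ (Set.Ioi z.1.2)] (fun ω =>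
        minValue φ n (move z a) (min m (z.1.1 + (a : ℤ))) (fun w => ξ w s ω) *
          minValue φ n (move z' b) (min m' (z'.1.1 + (b : ℤ))) (fun w => ξ w s' ω)) := by
    intro a b
    refine Measurable.mul ((measurable_minValue _ _ _ _ _).mono (rowAlgebra_mono ?_) le_rfl)
      ((measurable_minValue _ _ _ _ _).mono (rowAlgebra_mono ?_) le_rfl)
    · intro i hi; simp only [move_snd, Set.mem_Ico, Set.mem_Ioi] at *; omega
    · intro i hi; simp only [move_snd, Set.mem_Ico, Set.mem_Ioi] at *; omega
  have hint : ∀ a b, Integrable (fun ω =>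
      Set.indicator {ω | ξ z s ω = a ∧ ξ z' s' ω = b} (fun _ => (1 : ℝ)) ω *
        (minValue φ n (move z a) (min m (z.1.1 + (a : ℤ))) (fun w => ξ w s ω) *
          minValue φ n (move z' b) (min m' (z'.1.1 + (b : ℤ))) (fun w => ξ w s' ω))) P := by
    intro a b
    refine integrable_of_mem_Icc (Measurable.mul
      (measurable_const.indicator (hξ.rowAlgebra_le _ _ (hms a b)))
      ((hmeas a b).mono (hξ.rowAlgebra_le _) le_rfl)) fun ω => mul_mem_Icc ?_
        (mul_mem_Icc (minValue_mem hφ _ _ _ _) (minValue_mem hφ _ _ _ _))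
    by_cases h : ω ∈ {ω | ξ z s ω = a ∧ ξ z' s' ω = b} <;> simp [h]
  simp only [hpt]
  rw [integral_finsetSum _ fun a _ => integrable_finsetSum _ fun b _ => hint a b]
  refine Finset.sum_congr rfl fun a _ => ?_
  rw [integral_finsetSum _ fun b _ => hint a b]
  refine Finset.sum_congr rfl fun b _ => ?_
  rw [integral_mul_of_indep (hξ.rowAlgebra_le _) (hξ.rowAlgebra_le _)
    (hξ.indep_rowAlgebra (J := {z.1.2}) (J' := Set.Ioi z.1.2) (by simp))
    (measurable_const.indicator (hms a b)) (hmeas a b),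
    integral_indicator_const _ (hξ.rowAlgebra_le _ _ (hms a b))]
  simp

lemma IsDynamicalWeb.integral_minValue (hξ : IsDynamicalWeb P lam ξ) {φ : ℤ → ℝ}
    (hφ : ∀ m, φ m ∈ Set.Icc (0 : ℝ) 1) (n : ℕ) (z : Site) (m : ℤ) (s : ℝ≥0) :
    ∫ ω, minValue φ n z m (fun w => ξ w s ω) ∂P = meanMin φ n z.1.1 m := by
  induction n generalizing z m with
  | zero => simp [minValue, meanMin]
  | succ n ih =>
    have hms : ∀ a, MeasurableSet[rowAlgebra ξ {z.1.2}] {ω | ξ z s ω = a} :=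
      fun a => measurableSet_arrow (by simp) s a
    have hmeas : ∀ a : ℤˣ, Measurable[rowAlgebra ξ (Set.Ioi z.1.2)] (fun ω =>
        minValue φ n (move z a) (min m (z.1.1 + (a : ℤ))) (fun w => ξ w s ω)) := by
      intro a
      refine (measurable_minValue _ _ _ _ _).mono (rowAlgebra_mono ?_) le_rfl
      intro i hi; simp only [move_snd, Set.mem_Ico, Set.mem_Ioi] at *; omega
    have hpt : ∀ ω, minValue φ (n + 1) z m (fun w => ξ w s ω) =
        ∑ a, Set.indicator {ω | ξ z s ω = a} (fun _ => (1 : ℝ)) ω *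
          minValue φ n (move z a) (min m (z.1.1 + (a : ℤ))) (fun w => ξ w s ω) := by
      intro ω
      rw [Finset.sum_eq_single (ξ z s ω)]
      · simp [minValue, Set.indicator]
      · intro b _ hb; simp [Set.indicator, hb.symm]
      · exact fun h => (h (Finset.mem_univ _)).elim
    simp only [hpt]
    rw [integral_finsetSum]
    · have : ∀ a, ∫ ω, Set.indicator {ω | ξ z s ω = a} (fun _ => (1 : ℝ)) ω *
          minValue φ n (move z a) (min m (z.1.1 + (a : ℤ))) (fun w => ξ w s ω) ∂P =
          1 / 2 * meanMin φ n (z.1.1 + (a : ℤ)) (min m (z.1.1 + (a : ℤ))) := by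
        intro a
        rw [integral_mul_of_indep (hξ.rowAlgebra_le _) (hξ.rowAlgebra_le _)
          (hξ.indep_rowAlgebra (J := {z.1.2}) (J' := Set.Ioi z.1.2) (by simp))
          (measurable_const.indicator (hms a)) (hmeas a),
          integral_indicator_const _ (hξ.rowAlgebra_le _ _ (hms a)), ih,
          (hξ.flip z).real_eq_half (hξ.initial z)]
        simp
      simp only [this, sum_units, meanMin]
      push_cast
      rw [← sub_eq_add_neg]; ring
    · intro a _
      refine integrable_of_mem_Icc (Measurable.mul
        (measurable_const.indicator (hξ.rowAlgebra_le _ _ (hms a)))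
        ((hmeas a).mono (hξ.rowAlgebra_le _) le_rfl)) fun ω => mul_mem_Icc ?_
          (minValue_mem hφ _ _ _ _)
      by_cases h : ω ∈ {ω | ξ z s ω = a} <;> simp [h]

lemma IsDynamicalWeb.real_pair_self (hξ : IsDynamicalWeb P lam ξ) (z : Site) {s s' : ℝ≥0}
    (hs : s ≤ s') (a b : ℤˣ) : P.real {ω | ξ z s ω = a ∧ ξ z s' ω = b} =
      (1 + ((a * b : ℤˣ) : ℤ) * Real.exp (-(lam * (s' - s)))) / 4 := by
  rw [(hξ.flip z).real_two hs, (hξ.flip z).real_eq_half (hξ.initial z)]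
  ring_nf

lemma IsDynamicalWeb.real_pair_of_ne (hξ : IsDynamicalWeb P lam ξ) {z z' : Site} (hz : z ≠ z')
    (s s' : ℝ≥0) (a b : ℤˣ) : P.real {ω | ξ z s ω = a ∧ ξ z' s' ω = b} = 1 / 4 := by
  have h := (hξ.independent.indepFun hz).measure_inter_preimage_eq_mul
    ((fun f => f s) ⁻¹' {a}) ((fun f => f s') ⁻¹' {b}) (measurable_pi_apply s (measurableSet_singleton a))
    (measurable_pi_apply s' (measurableSet_singleton b))
  have h' : P.real {ω | ξ z s ω = a ∧ ξ z' s' ω = b} =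
      P.real {ω | ξ z s ω = a} * P.real {ω | ξ z' s' ω = b} := by
    rw [measureReal_def, measureReal_def, measureReal_def, ← ENNReal.toReal_mul]
    exact congrArg ENNReal.toReal h
  rw [h', (hξ.flip z).real_eq_half (hξ.initial z), (hξ.flip z').real_eq_half (hξ.initial z')]
  norm_num

/-- A supersolution for the expected collision number of a pair of sticky walks at distance `d`
with `n` steps to go. -/
noncomputable def collisionBound (A : ℝ) (n : ℕ) (d : ℤ) : ℝ :=
  (((d : ℝ) ^ 2 + 2 * n) / A + A) / 2 - |(d : ℝ)|

lemma collisionBound_zero_nonneg {A : ℝ} (hA : 0 < A) (d : ℤ) : 0 ≤ collisionBound A 0 d := by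
  have : 2 * |(d : ℝ)| ≤ (d : ℝ) ^ 2 / A + A := by
    rw [← sub_nonneg]
    have : (d : ℝ) ^ 2 / A + A - 2 * |(d : ℝ)| = (|(d : ℝ)| - A) ^ 2 / A := by
      rw [← sq_abs (d : ℝ)]; field_simp; ring
    rw [this]; positivity
  simp only [collisionBound, Nat.cast_zero, mul_zero, add_zero]
  linarith

lemma collisionBound_succ_of_ne {A : ℝ} (n : ℕ) {d : ℤ} (hd : d ≠ 0) (he : Even d) :
    collisionBound A (n + 1) d =
      (2 * collisionBound A n d + collisionBound A n (d + 2) + collisionBound A n (d - 2)) / 4 := by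
  obtain ⟨c, rfl⟩ := he
  have hc : c ≤ -1 ∨ 1 ≤ c := by omega
  have habs : |((c + c + 2 : ℤ) : ℝ)| + |((c + c - 2 : ℤ) : ℝ)| = 2 * |((c + c : ℤ) : ℝ)| := by
    rw [← Int.cast_abs, ← Int.cast_abs, ← Int.cast_abs]
    have : |c + c + 2| + |c + c - 2| = 2 * |c + c| := by
      rcases hc with hc | hc
      · rw [abs_of_nonpos, abs_of_nonpos, abs_of_nonpos] <;> omega
      · rw [abs_of_nonneg, abs_of_nonneg, abs_of_nonneg] <;> omega
    exact_mod_cast this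
  have e : ∀ k x y z : ℝ, y + z = 2 * x →
      (((k ^ 2 + 2 * (n + 1)) / A + A) / 2 - x) = (2 * (((k ^ 2 + 2 * n) / A + A) / 2 - x) +
        ((((k + 2) ^ 2 + 2 * n) / A + A) / 2 - y) +
        ((((k - 2) ^ 2 + 2 * n) / A + A) / 2 - z)) / 4 := by
    intro k x y z h
    have : x = (y + z) / 2 := by linarith
    rw [this]; ring
  have := e ((c + c : ℤ) : ℝ) _ _ _ habs
  simp only [collisionBound]
  push_cast at this ⊢
  exact this

lemma collisionBound_succ_zero {A ρ : ℝ} (hA : 0 < A) (hρ : 0 ≤ ρ) (n : ℕ) :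
    ((1 + ρ) * (2 * collisionBound A n 0) +
      (1 - ρ) * (collisionBound A n 2 + collisionBound A n (-2))) / 4 ≤
      collisionBound A (n + 1) 0 - (1 - ρ) := by
  simp only [collisionBound]
  norm_num
  have : 0 ≤ ρ / A := by positivity
  rw [← sub_nonneg]
  ring_nf
  rw [mul_comm, ← div_eq_mul_inv]
  linarith

/-- The decorrelation estimate: the covariance of a Lipschitz function of the minimum of the path,
taken at two dynamical times, is controlled by the collisions of the two paths. -/
lemma IsDynamicalWeb.integral_minValue_mul_le (hξ : IsDynamicalWeb P lam ξ) {φ : ℤ → ℝ}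
    (hφ : ∀ m, φ m ∈ Set.Icc (0 : ℝ) 1) {L : ℝ} (hL : 0 ≤ L)
    (hLip : ∀ m m', |φ m - φ m'| ≤ L * |(m - m' : ℤ)|) {s s' : ℝ≥0} (hs : s ≤ s')
    {A c : ℝ} (hA : 0 < A) (hc : 0 ≤ c) (hρ : Real.exp (-(lam * (s' - s))) ≤ 1)
    (hcρ : L ^ 2 * Real.exp (-(lam * (s' - s))) = c * (1 - Real.exp (-(lam * (s' - s)))))
    (n : ℕ) {z z' : Site} (hr : z.1.2 = z'.1.2) (m m' : ℤ) :
    ∫ ω, minValue φ n z m (fun w => ξ w s ω) * minValue φ n z' m' (fun w => ξ w s' ω) ∂P ≤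
      meanMin φ n z.1.1 m * meanMin φ n z'.1.1 m' +
        c * collisionBound A n (z.1.1 - z'.1.1) := by
  set ρ := Real.exp (-(lam * (s' - s))) with hρdef
  have hρ0 : 0 ≤ ρ := (Real.exp_pos _).le
  induction n generalizing z z' m m' with
  | zero =>
    simpa [minValue, meanMin] using mul_nonneg hc (collisionBound_zero_nonneg hA _)
  | succ n ih =>
    rw [hξ.integral_minValue_mul_succ hφ n hr]
    have key : ∀ a b : ℤˣ, _ := fun a b => ih (z := move z a) (z' := move z' b)
      (by simp [hr]) (min m (z.1.1 + a)) (min m' (z'.1.1 + b))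
    simp only [sum_units]
    have k1 := key 1 1
    have k2 := key 1 (-1)
    have k3 := key (-1) 1
    have k4 := key (-1) (-1)
    simp only [move_fst, Units.val_one, Units.val_neg, ← sub_eq_add_neg] at k1 k2 k3 k4 ⊢
    generalize hd : z.1.1 - z'.1.1 = d at *
    rw [show z.1.1 + 1 - (z'.1.1 + 1) = d by omega] at k1
    rw [show z.1.1 + 1 - (z'.1.1 - 1) = d + 2 by omega] at k2
    rw [show z.1.1 - 1 - (z'.1.1 + 1) = d - 2 by omega] at k3
    rw [show z.1.1 - 1 - (z'.1.1 - 1) = d by omega] at k4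
    simp only [meanMin]
    by_cases hz : z = z'
    · subst hz
      have hd0 : d = 0 := by omega
      subst hd0
      simp only [hξ.real_pair_self z hs]
      rw [← hρdef]
      have hLip1 := abs_meanMin_sub_le hLip hL n (x := z.1.1 + 1) (y := z.1.1 - 1)
        (m := min m (z.1.1 + 1)) (m' := min m (z.1.1 - 1)) (d := 2) (by rw [abs_le]; omega)
        ((abs_min_sub_min_le_max _ _ _ _).trans (max_le (by simp) (by rw [abs_le]; omega)))
      have hLip2 := abs_meanMin_sub_le hLip hL n (x := z.1.1 + 1) (y := z.1.1 - 1)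
        (m := min m' (z.1.1 + 1)) (m' := min m' (z.1.1 - 1)) (d := 2) (by rw [abs_le]; omega)
        ((abs_min_sub_min_le_max _ _ _ _).trans (max_le (by simp) (by rw [abs_le]; omega)))
      have hprod := (le_abs_self _).trans ((abs_mul _ _).trans_le
        (mul_le_mul hLip1 hLip2 (abs_nonneg _) (by positivity)))
      have hcol := mul_le_mul_of_nonneg_left (collisionBound_succ_zero hA hρ0 n) hc
      have w1 := mul_le_mul_of_nonneg_left k1 (show 0 ≤ (1 + ρ) / 4 by linarith)
      have w4 := mul_le_mul_of_nonneg_left k4 (show 0 ≤ (1 + ρ) / 4 by linarith)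
      have w2 := mul_le_mul_of_nonneg_left k2 (show 0 ≤ (1 - ρ) / 4 by linarith)
      have w3 := mul_le_mul_of_nonneg_left k3 (show 0 ≤ (1 - ρ) / 4 by linarith)
      have w5 := mul_le_mul_of_nonneg_left hprod hρ0
      norm_num at w1 w2 w3 w4 w5 hcol hcρ ⊢
      linarith
    · have hd0 : d ≠ 0 := fun h => hz (site_ext hr (by omega))
      have he : Even d := hd ▸ even_sub_of_row_eq hr
      simp only [hξ.real_pair_of_ne hz]
      rw [collisionBound_succ_of_ne n hd0 he]
      linarith

end moments

/-- The piecewise linear function which increases from `0` at `x₀ - 2 b` to `1` at `x₀ - b`. -/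
noncomputable def ramp (x₀ : ℤ) (b : ℝ) (m : ℤ) : ℝ := max 0 (min 1 (2 + (m - x₀) / b))

lemma ramp_mem (x₀ : ℤ) (b : ℝ) (m : ℤ) : ramp x₀ b m ∈ Set.Icc (0 : ℝ) 1 :=
  ⟨le_max_left _ _, max_le zero_le_one (min_le_left _ _)⟩

lemma ramp_eq_one {x₀ : ℤ} {b : ℝ} (hb : 0 < b) {m : ℤ} (h : (x₀ : ℝ) - b ≤ m) :
    ramp x₀ b m = 1 := by
  have : -1 ≤ ((m : ℝ) - x₀) / b := by rw [le_div_iff₀ hb]; linarith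
  rw [ramp, min_eq_left (by linarith), max_eq_right zero_le_one]

lemma le_of_ramp_pos {x₀ : ℤ} {b : ℝ} (hb : 0 < b) {m : ℤ} (h : 0 < ramp x₀ b m) :
    (x₀ : ℝ) - 2 * b ≤ m := by
  rw [ramp, lt_max_iff, lt_min_iff] at h
  have h : 0 < 2 + ((m : ℝ) - x₀) / b := by simpa using h
  have : -2 ≤ ((m : ℝ) - x₀) / b := by linarith
  rw [le_div_iff₀ hb] at this; linarith

lemma abs_ramp_sub_le (x₀ : ℤ) {b : ℝ} (hb : 0 < b) (m m' : ℤ) :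
    |ramp x₀ b m - ramp x₀ b m'| ≤ 1 / b * |(m - m' : ℤ)| := by
  refine (abs_max_sub_max_le_max _ _ _ _).trans (max_le (by simp; positivity) ?_)
  refine (abs_min_sub_min_le_max _ _ _ _).trans (max_le (by simp; positivity) ?_)
  rw [show 2 + ((m : ℝ) - x₀) / b - (2 + ((m' : ℝ) - x₀) / b) = 1 / b * (m - m' : ℤ) by
    push_cast; ring, abs_mul, abs_of_pos (by positivity : 0 < 1 / b), Int.cast_abs]

lemma four_pow_eq (k : ℕ) : (4 : ℝ) ^ k = (2 ^ k) ^ 2 := by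
  rw [← pow_mul, mul_comm, pow_mul]; norm_num

/-- The number of steps in the `k`-th strip. -/
def stripLen (a k : ℕ) : ℕ := 4 ^ (k + 1) * a ^ 2

/-- The first row of the `k`-th strip. -/
def stripRow (a k : ℕ) : ℕ := ∑ j ∈ Finset.range k, stripLen a j

/-- The spatial scale of the `k`-th strip. -/
def stripWidth (a k : ℕ) : ℕ := 2 ^ (k + 2) * a

/-- The position at which the path of the `k`-th strip starts. -/
def stripLeft (a k : ℕ) : ℤ := -(8 * a * (2 ^ k - 1))

/-- The site at which the path of the `k`-th strip starts. -/
def stripStart (a k : ℕ) : Site :=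
  ⟨(stripLeft a k, stripRow a k), by
    refine Even.add ?_ ?_
    · exact (Even.mul_right (Even.mul_right (by decide) _) _).neg
    · rw [Int.even_coe_nat]
      exact Finset.even_sum _ fun j _ => Even.mul_right (Even.pow_of_ne_zero (by decide) (by simp)) _⟩

/-- A function of the configuration which is positive only if the path of the `k`-th strip stays
within that strip to the right of the start of the next strip. -/
noncomputable def stripValue (a k : ℕ) (η : Site → ℤˣ) : ℝ :=
  minValue (ramp (stripLeft a k) (stripWidth a k)) (stripLen a k) (stripStart a k) (stripLeft a k) η

/-- The mean of `stripValue`. -/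
noncomputable def stripMean (a k : ℕ) : ℝ :=
  meanMin (ramp (stripLeft a k) (stripWidth a k)) (stripLen a k) (stripLeft a k) (stripLeft a k)

lemma stripRow_succ (a k : ℕ) : stripRow a (k + 1) = stripRow a k + stripLen a k :=
  Finset.sum_range_succ _ _

lemma stripLeft_succ (a k : ℕ) : stripLeft a (k + 1) = stripLeft a k - 2 * stripWidth a k := by
  simp only [stripLeft, stripWidth]; push_cast; ring

lemma stripWidth_sq (a k : ℕ) : (stripWidth a k : ℝ) ^ 2 = 4 * stripLen a k := by
  simp only [stripLen, stripWidth]; push_cast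
  rw [four_pow_eq]; ring

lemma stripWidth_pos {a : ℕ} (ha : 1 ≤ a) (k : ℕ) : (0 : ℝ) < stripWidth a k := by
  simp only [stripWidth]; exact_mod_cast Nat.mul_pos (by positivity) ha

lemma stripValue_mem (a k : ℕ) (η : Site → ℤˣ) : stripValue a k η ∈ Set.Icc (0 : ℝ) 1 :=
  minValue_mem (ramp_mem _ _) _ _ _ _

lemma le_stripMean {a : ℕ} (ha : 1 ≤ a) (k : ℕ) : 3 / 4 ≤ stripMean a k := by
  have hb := stripWidth_pos ha k
  refine le_trans ?_ (one_sub_le_meanMin (ramp_mem _ _) hb (fun m hm => ramp_eq_one hb hm)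
    (stripLen a k) (stripLeft a k) (stripLeft a k) (by linarith))
  rw [stripWidth_sq]
  have : (0 : ℝ) < stripLen a k := by
    have := stripWidth_sq a k
    nlinarith [pow_pos hb 2]
  field_simp
  norm_num
  linarith

/-- If all strips are good, then the path from the origin is to the right of the start of each
strip. -/
lemma walk_ge_of_stripValue_pos {a : ℕ} (ha : 1 ≤ a) {η : Site → ℤˣ}
    (h : ∀ k, 0 < stripValue a k η) (k : ℕ) :
    stripLeft a k ≤ walk η (stripRow a k) ∧
      ∀ j ≤ stripLen a k, stripLeft a (k + 1) ≤ walk η (stripRow a k + j) := by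
  have hstrip : ∀ k, ∀ j ≤ stripLen a k,
      stripLeft a (k + 1) ≤ ((step η)^[j] (stripStart a k)).1.1 := by
    intro k j hj
    have hb := stripWidth_pos ha k
    have := le_of_minValue_pos (B := stripLeft a (k + 1)) (fun m hm => by
      have := le_of_ramp_pos hb hm
      rw [stripLeft_succ]; exact_mod_cast this) (h k)
    cases j with
    | zero => exact this.1
    | succ j => exact this.2 j (by omega)
  have hcross : ∀ k, stripLeft a k ≤ walk η (stripRow a k) → ∀ j ≤ stripLen a k,
      stripLeft a (k + 1) ≤ walk η (stripRow a k + j) := by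
    intro k hk j hj
    refine (hstrip k j hj).trans ?_
    rw [walk, add_comm, Function.iterate_add_apply]
    refine iterate_step_mono η ?_ hk j
    rw [iterate_step_snd]; simp [stripStart, origin]
  have hleft : stripLeft a k ≤ walk η (stripRow a k) := by
    induction k with
    | zero => simp [stripLeft, stripRow, walk, origin]
    | succ k ih => rw [stripRow_succ]; exact hcross k ih _ le_rfl
  exact ⟨hleft, hcross k hleft⟩

lemma exists_strip {a : ℕ} (ha : 1 ≤ a) (n : ℕ) :
    ∃ k, ∃ j ≤ stripLen a k, n = stripRow a k + j := by
  have hlen : ∀ k, 1 ≤ stripLen a k := fun k => Nat.mul_pos (by positivity) (by positivity)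
  induction n with
  | zero => exact ⟨0, 0, by simp [stripRow]⟩
  | succ n ih =>
    obtain ⟨k, j, hj, rfl⟩ := ih
    rcases hj.eq_or_lt with rfl | hj
    · exact ⟨k + 1, 1, hlen _, by rw [stripRow_succ]⟩
    · exact ⟨k, j + 1, hj, by omega⟩

lemma le_stripRow (a k : ℕ) : 4 ^ (k + 1) * a ^ 2 ≤ stripRow a (k + 1) := by
  rw [stripRow_succ]; exact Nat.le_add_left _ _

lemma neg_le_walk (η : Site → ℤˣ) (n : ℕ) : -(n : ℤ) ≤ walk η n := by
  have : ∀ n : ℕ, -(n : ℤ) ≤ ((step η)^[n] origin).1.1 := by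
    intro n
    induction n with
    | zero => simp [origin]
    | succ n ih =>
      rw [Function.iterate_succ_apply', step_eq_move, move_fst]
      rcases Int.units_eq_one_or (η ((step η)^[n] origin)) with h | h <;> rw [h] <;>
        push_cast <;> omega
  exact this n

/-- If all strips are good, then the path stays above a square-root barrier. -/
lemma barrier_le_walk {a : ℕ} (ha : 1 ≤ a) {η : Site → ℤˣ} (h : ∀ k, 0 < stripValue a k η)
    {κ : ℝ} (hκ : 0 ≤ κ) (haκ : a = 1 ∨ 8 * a ≤ κ) (n : ℕ) :
    -κ - 16 * √n ≤ walk η n := by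
  obtain ⟨k, j, hj, rfl⟩ := exists_strip ha n
  have hw := (walk_ge_of_stripValue_pos ha h k).2 j hj
  have hw' : (stripLeft a (k + 1) : ℝ) ≤ walk η (stripRow a k + j) := by exact_mod_cast hw
  cases k with
  | zero =>
    have hs := Real.sqrt_nonneg ((stripRow a 0 + j : ℕ) : ℝ)
    rcases haκ with rfl | haκ
    · have h1 : (-((stripRow 1 0 + j : ℕ) : ℝ)) ≤ walk η (stripRow 1 0 + j) := by
        exact_mod_cast neg_le_walk η _
      have h2 : ((stripRow 1 0 + j : ℕ) : ℝ) ≤ 4 := by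
        simp [stripRow, stripLen] at hj ⊢; exact_mod_cast hj
      have h3 := Real.mul_self_sqrt (Nat.cast_nonneg (α := ℝ) (stripRow 1 0 + j))
      have h4 : √((stripRow 1 0 + j : ℕ) : ℝ) ≤ 2 := by
        rw [Real.sqrt_le_left (by norm_num)]; linarith
      nlinarith
    · have : (stripLeft a (0 + 1) : ℝ) = -(8 * a) := by simp [stripLeft]
      linarith
  | succ k =>
    have h1 : (2 ^ (k + 1) * a : ℝ) ≤ √((stripRow a (k + 1) + j : ℕ) : ℝ) := by
      refine Real.le_sqrt_of_sq_le ?_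
      have : ((4 ^ (k + 1) * a ^ 2 : ℕ) : ℝ) ≤ ((stripRow a (k + 1) + j : ℕ) : ℝ) := by
        exact_mod_cast (le_stripRow a k).trans (Nat.le_add_right _ _)
      refine le_trans (le_of_eq ?_) this
      push_cast
      rw [four_pow_eq]; ring
    have h2 : (stripLeft a (k + 1 + 1) : ℝ) = -(16 * (2 ^ (k + 1) * a)) + 8 * a := by
      simp only [stripLeft]; push_cast; ring
    have h3 : (0 : ℝ) ≤ 8 * a := by positivity
    linarith

lemma IsDynamicalWeb.measurable_stripValue {Ω : Type u} [MeasurableSpace Ω]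
    {P : Measure Ω} {lam : ℝ} {ξ : Site → ℝ≥0 → Ω → ℤˣ} (hξ : IsDynamicalWeb P lam ξ) (a k : ℕ) (s : ℝ≥0) :
    Measurable (fun ω => stripValue a k (fun w => ξ w s ω)) :=
  (measurable_minValue _ _ _ _ _).mono (hξ.rowAlgebra_le _) le_rfl

section moments

variable {Ω : Type u} [MeasurableSpace Ω] {P : Measure Ω} [IsProbabilityMeasure P] {lam : ℝ}
  {ξ : Site → ℝ≥0 → Ω → ℤˣ}

lemma IsDynamicalWeb.integral_stripValue (hξ : IsDynamicalWeb P lam ξ) (a k : ℕ) (s : ℝ≥0) :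
    ∫ ω, stripValue a k (fun w => ξ w s ω) ∂P = stripMean a k :=
  hξ.integral_minValue (ramp_mem _ _) _ _ _ _

lemma IsDynamicalWeb.integral_stripValue_mul_le_of_lt (hξ : IsDynamicalWeb P lam ξ)
    (hlam : 0 < lam) {a : ℕ} (ha : 1 ≤ a) (k : ℕ) {s s' : ℝ≥0} (hs : s < s') :
    ∫ ω, stripValue a k (fun w => ξ w s ω) * stripValue a k (fun w => ξ w s' ω) ∂P ≤
      stripMean a k ^ 2 + 1 / (stripWidth a k * (lam * (s' - s))) := by
  have hb := stripWidth_pos ha k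
  set b : ℝ := (stripWidth a k : ℝ) with hbdef
  have hy : 0 < lam * ((s' : ℝ) - s) := mul_pos hlam (sub_pos.2 (NNReal.coe_lt_coe.2 hs))
  set y := lam * ((s' : ℝ) - s) with hydef
  have hρ1 : Real.exp (-y) < 1 := by rw [Real.exp_lt_one_iff]; linarith
  set ρ := Real.exp (-y) with hρ
  have hρ0 : 0 < ρ := Real.exp_pos _
  have hsub : (1 - ρ) ≠ 0 := by linarith
  have hmain := hξ.integral_minValue_mul_le (ramp_mem (stripLeft a k) b) (L := 1 / b)
    (by positivity) (abs_ramp_sub_le _ hb) hs.le (A := b) (c := (1 / b) ^ 2 * (ρ / (1 - ρ))) hb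
    (mul_nonneg (by positivity) (div_nonneg hρ0.le (by linarith))) hρ1.le
    (by rw [← hydef, ← hρ]; field_simp) (stripLen a k) (z := stripStart a k)
    (z' := stripStart a k) rfl (stripLeft a k) (stripLeft a k)
  refine hmain.trans ?_
  rw [sub_self, ← sq]
  refine add_le_add le_rfl ?_
  have hcol : collisionBound b (stripLen a k) 0 = 3 / 4 * b := by
    have : (stripLen a k : ℝ) = b ^ 2 / 4 := by rw [hbdef, stripWidth_sq]; ring
    simp only [collisionBound, this]; field_simp; norm_num; ring
  have hfrac : ρ / (1 - ρ) ≤ 1 / y := by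
    rw [div_le_div_iff₀ (by linarith) hy]
    have h1 := Real.add_one_le_exp y
    have h2 : ρ * Real.exp y = 1 := by rw [hρ, ← Real.exp_add]; simp
    nlinarith
  rw [hcol]
  calc (1 / b) ^ 2 * (ρ / (1 - ρ)) * (3 / 4 * b) = 3 / 4 * (1 / b) * (ρ / (1 - ρ)) := by
        field_simp
    _ ≤ 1 * (1 / b) * (1 / y) := by gcongr; norm_num
    _ = 1 / (b * y) := by field_simp

/-- The bound for the normalized correlation of two strips, as a function of the renormalized
difference of the dynamical times. -/
noncomputable def corrBound (y : ℝ) : ℝ := min (4 / 3) (1 + 1 / y)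

lemma IsDynamicalWeb.integral_stripValue_mul_le (hξ : IsDynamicalWeb P lam ξ)
    (hlam : 0 < lam) {a : ℕ} (ha : 1 ≤ a) {κ : ℝ} (hκ : 0 < κ) (hκa : κ ≤ a * lam) (k : ℕ)
    {s s' : ℝ≥0} (hs : s ≠ s') :
    ∫ ω, stripValue a k (fun w => ξ w s ω) * stripValue a k (fun w => ξ w s' ω) ∂P ≤
      stripMean a k ^ 2 * corrBound (2 ^ k * (κ * |(s : ℝ) - s'|)) := by
  wlog hlt : s < s' generalizing s s'
  · have := this hs.symm (lt_of_le_of_ne (not_lt.1 hlt) hs.symm)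
    rw [abs_sub_comm]
    simpa only [mul_comm] using this
  have hp := le_stripMean ha k
  have hτ : (0 : ℝ) < s' - s := sub_pos.2 (NNReal.coe_lt_coe.2 hlt)
  rw [abs_sub_comm, abs_of_pos hτ, corrBound, mul_min_of_nonneg _ _ (sq_nonneg _)]
  refine le_min ?_ ?_
  · calc ∫ ω, stripValue a k (fun w => ξ w s ω) * stripValue a k (fun w => ξ w s' ω) ∂P
        ≤ ∫ ω, stripValue a k (fun w => ξ w s ω) ∂P := by
          refine integral_mono (integrable_of_mem_Icc ((hξ.measurable_stripValue _ _ _).mul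
            (hξ.measurable_stripValue _ _ _)) fun _ => mul_mem_Icc (stripValue_mem _ _ _)
            (stripValue_mem _ _ _)) (integrable_of_mem_Icc (hξ.measurable_stripValue _ _ _)
            fun _ => stripValue_mem _ _ _) fun ω => ?_
          exact mul_le_of_le_one_right (stripValue_mem _ _ _).1 (stripValue_mem _ _ _).2
      _ = stripMean a k := hξ.integral_stripValue a k s
      _ ≤ _ := by nlinarith
  · refine (hξ.integral_stripValue_mul_le_of_lt hlam ha k hlt).trans ?_
    rw [mul_add, mul_one]
    refine add_le_add le_rfl ?_
    have e : (stripWidth a k * (lam * (s' - s)) : ℝ) = 4 * (2 ^ k * (a * lam * (s' - s))) := by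
      simp only [stripWidth]; push_cast; ring
    rw [e]
    calc 1 / (4 * (2 ^ k * (a * lam * (s' - s)))) ≤ 1 / (4 * (2 ^ k * (κ * (s' - s)))) := by
          gcongr
      _ = 1 / 4 * (1 / (2 ^ k * (κ * (s' - s)))) := by field_simp
      _ ≤ stripMean a k ^ 2 * (1 / (2 ^ k * (κ * (s' - s)))) := by
          gcongr; nlinarith

lemma IsDynamicalWeb.integral_stripValue_sq_le (hξ : IsDynamicalWeb P lam ξ)
    {a : ℕ} (ha : 1 ≤ a) (k : ℕ) (s : ℝ≥0) :
    ∫ ω, stripValue a k (fun w => ξ w s ω) * stripValue a k (fun w => ξ w s ω) ∂P ≤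
      stripMean a k ^ 2 * (4 / 3) := by
  have hp := le_stripMean ha k
  calc ∫ ω, stripValue a k (fun w => ξ w s ω) * stripValue a k (fun w => ξ w s ω) ∂P
      ≤ ∫ ω, stripValue a k (fun w => ξ w s ω) ∂P := by
        refine integral_mono (integrable_of_mem_Icc ((hξ.measurable_stripValue _ _ _).mul
          (hξ.measurable_stripValue _ _ _)) fun _ => mul_mem_Icc (stripValue_mem _ _ _)
          (stripValue_mem _ _ _)) (integrable_of_mem_Icc (hξ.measurable_stripValue _ _ _)
          fun _ => stripValue_mem _ _ _) fun ω => ?_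
        exact mul_le_of_le_one_right (stripValue_mem _ _ _).1 (stripValue_mem _ _ _).2
    _ = stripMean a k := hξ.integral_stripValue a k s
    _ ≤ _ := by nlinarith

end moments

lemma half_le_prod (n : ℕ) :
    (1 : ℝ) / 2 + (1 / 2) ^ (n + 1) ≤ ∏ k ∈ Finset.range n, (1 - (1 / 2 : ℝ) ^ (k + 2)) := by
  induction n with
  | zero => norm_num
  | succ n ih =>
    rw [Finset.prod_range_succ]
    have hq0 : (0 : ℝ) < (1 / 2) ^ (n + 1) := by positivity
    have hq1 : (1 / 2 : ℝ) ^ (n + 1) ≤ 1 / 2 := by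
      rw [pow_succ]
      have : (1 / 2 : ℝ) ^ n ≤ 1 := pow_le_one₀ (by norm_num) (by norm_num)
      linarith
    rw [show (1 / 2 : ℝ) ^ (n + 2) = (1 / 2) ^ (n + 1) / 2 by ring]
    generalize (1 / 2 : ℝ) ^ (n + 1) = q at *
    calc (1 : ℝ) / 2 + q / 2 ≤ (1 / 2 + q) * (1 - q / 2) := by nlinarith
      _ ≤ _ := mul_le_mul_of_nonneg_right ih (by linarith)

lemma corrBound_nonneg {y : ℝ} (hy : 0 < y) : 0 ≤ corrBound y :=
  le_min (by norm_num) (by positivity)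

lemma prod_corrBound_succ (n : ℕ) (y : ℝ) :
    ∏ k ∈ Finset.range (n + 1), corrBound (2 ^ k * y) =
      corrBound y * ∏ k ∈ Finset.range n, corrBound (2 ^ k * (2 * y)) := by
  rw [Finset.prod_range_succ', mul_comm]
  simp only [pow_zero, one_mul, pow_succ, mul_assoc]

lemma prod_corrBound_nonneg (n : ℕ) {y : ℝ} (hy : 0 < y) :
    0 ≤ ∏ k ∈ Finset.range n, corrBound (2 ^ k * y) :=
  Finset.prod_nonneg fun _ _ => corrBound_nonneg (by positivity)

lemma prod_corrBound_le_exp (n : ℕ) {y : ℝ} (hy : 0 < y) :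
    ∏ k ∈ Finset.range n, corrBound (2 ^ k * y) ≤ Real.exp (2 / y) := by
  induction n generalizing y with
  | zero => simp; positivity
  | succ n ih =>
    rw [prod_corrBound_succ]
    have h1 : corrBound y ≤ Real.exp (1 / y) :=
      (min_le_right _ _).trans (by linarith [Real.add_one_le_exp (1 / y)])
    calc _ ≤ Real.exp (1 / y) * Real.exp (2 / (2 * y)) :=
          mul_le_mul h1 (ih (by positivity)) (prod_corrBound_nonneg _ (by positivity))
            (Real.exp_pos _).le
      _ = Real.exp (2 / y) := by rw [← Real.exp_add]; congr 1; field_simp; norm_num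

lemma exp_two_le : Real.exp 2 ≤ 9 := by
  have h := Real.exp_one_lt_d9
  have : Real.exp 2 = Real.exp 1 * Real.exp 1 := by rw [← Real.exp_add]; norm_num
  rw [this]
  nlinarith [Real.exp_pos 1]

lemma prod_corrBound_le_of_le_one (n : ℕ) {y : ℝ} (hy : 0 < y) (hy1 : y ≤ 1) :
    ∏ k ∈ Finset.range n, corrBound (2 ^ k * y) ≤ 16 / √y := by
  have hsq : ∀ {y : ℝ}, 0 < y → y ≤ 1 → 16 ≤ 16 / √y := fun hy hy1 => by
    rw [le_div_iff₀ (Real.sqrt_pos.2 hy)]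
    have : √_ ≤ 1 := Real.sqrt_le_one.2 hy1
    linarith
  induction n generalizing y with
  | zero => simpa using le_trans (by norm_num) (hsq hy hy1)
  | succ n ih =>
    rw [prod_corrBound_succ]
    have h1 : corrBound y ≤ 4 / 3 := min_le_left _ _
    have h0 := prod_corrBound_nonneg n (y := 2 * y) (by positivity)
    refine (mul_le_mul_of_nonneg_right h1 h0).trans ?_
    by_cases h : 2 * y ≤ 1
    · refine (mul_le_mul_of_nonneg_left (ih (by positivity) h) (by norm_num)).trans ?_
      rw [Real.sqrt_mul (by norm_num)]
      have h2 : (4 : ℝ) / 3 ≤ √2 := Real.le_sqrt_of_sq_le (by norm_num)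
      have hs := Real.sqrt_pos.2 hy
      rw [← mul_div_assoc, div_le_div_iff₀ (by positivity) hs]
      nlinarith
    · push Not at h
      have h2 := prod_corrBound_le_exp n (y := 2 * y) (by positivity)
      have h3 : Real.exp (2 / (2 * y)) ≤ Real.exp 2 := by
        rw [Real.exp_le_exp, div_le_iff₀ (by positivity)]; linarith
      linarith [hsq hy hy1, exp_two_le]

lemma prod_corrBound_le (n : ℕ) {y : ℝ} (hy : 0 < y) :
    ∏ k ∈ Finset.range n, corrBound (2 ^ k * y) ≤ 16 * (1 + 1 / √y) := by
  have : 0 ≤ 1 / √y := by positivity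
  by_cases h : y ≤ 1
  · have := prod_corrBound_le_of_le_one n hy h
    rw [mul_add, mul_one_div]; linarith
  · have h2 := prod_corrBound_le_exp n hy
    have h3 : Real.exp (2 / y) ≤ Real.exp 2 := by
      rw [Real.exp_le_exp, div_le_iff₀ (by positivity)]; push Not at h; linarith
    linarith [exp_two_le]

lemma one_div_sqrt_le (n : ℕ) : 1 / √((n : ℝ) + 1) ≤ 2 * (√((n : ℝ) + 1) - √n) := by
  have h1 : 0 < √((n : ℝ) + 1) := Real.sqrt_pos.2 (by positivity)
  have h2 := Real.sqrt_nonneg (n : ℝ)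
  have h3 := Real.mul_self_sqrt (show (0 : ℝ) ≤ n + 1 by positivity)
  have h4 := Real.mul_self_sqrt (show (0 : ℝ) ≤ n by positivity)
  rw [div_le_iff₀ h1]
  nlinarith [sq_nonneg (√((n : ℝ) + 1) - √n)]

lemma sum_one_div_sqrt_sub_le (i : ℕ) :
    ∑ j ∈ Finset.range i, 1 / √|(i : ℝ) - j| ≤ 2 * √i := by
  induction i with
  | zero => simp
  | succ i ih =>
    rw [Finset.sum_range_succ']
    have h := one_div_sqrt_le i
    have e : ∀ j ∈ Finset.range i, 1 / √|((i + 1 : ℕ) : ℝ) - ((j + 1 : ℕ) : ℝ)| =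
        1 / √|(i : ℝ) - j| := fun j _ => by push_cast; rw [add_sub_add_right_eq_sub]
    rw [Finset.sum_congr rfl e]
    push_cast
    rw [sub_zero, abs_of_nonneg (show (0 : ℝ) ≤ i + 1 by positivity)]
    linarith

lemma sum_one_div_sqrt_le (r : ℕ) :
    ∑ j ∈ Finset.range (r + 1), 1 / √(j : ℝ) ≤ 2 * √r := by
  induction r with
  | zero => simp
  | succ r ih =>
    rw [Finset.sum_range_succ]
    have h := one_div_sqrt_le r
    push_cast at *
    linarith

lemma sum_range_one_div_sqrt_le {i N : ℕ} (hi : i < N) :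
    ∑ j ∈ Finset.range N, 1 / √|(i : ℝ) - j| ≤ 4 * √N := by
  obtain ⟨r, rfl⟩ := Nat.exists_eq_add_of_lt hi
  rw [add_assoc, Finset.sum_range_add]
  have h1 := sum_one_div_sqrt_sub_le i
  have h2 := sum_one_div_sqrt_le r
  have e : ∀ j ∈ Finset.range (r + 1), 1 / √|(i : ℝ) - ((i + j : ℕ) : ℝ)| = 1 / √(j : ℝ) :=
    fun j _ => by push_cast; rw [sub_add_cancel_left, abs_neg, abs_of_nonneg (by positivity)]
  rw [Finset.sum_congr rfl e]
  have h3 : √(i : ℝ) ≤ √((i + (r + 1) : ℕ) : ℝ) := Real.sqrt_le_sqrt (by push_cast; linarith)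
  have h4 : √(r : ℝ) ≤ √((i + (r + 1) : ℕ) : ℝ) := Real.sqrt_le_sqrt (by
    push_cast; linarith [(Nat.cast_nonneg i : (0 : ℝ) ≤ i)])
  linarith

/-- The event that no arrow which may matter for the `k`-th strip changes at distance less than `h`
from the dynamical time `s`. -/
def stripStable {Ω : Type u} (ξ : Site → ℝ≥0 → Ω → ℤˣ) (a k : ℕ) (h s : ℝ≥0) : Set Ω :=
  ⋂ z ∈ reach (stripLen a k) (stripStart a k), (flipsIn (ξ z) (s - h) (2 * h))ᶜ

/-- `stripValue` at the dynamical time `s`, set to zero unless the strip is stable around `s`. -/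
noncomputable def stableValue {Ω : Type u} (ξ : Site → ℝ≥0 → Ω → ℤˣ) (a k : ℕ) (h s : ℝ≥0) :
    Ω → ℝ :=
  (stripStable ξ a k h s).indicator fun ω => stripValue a k (fun w => ξ w s ω)

section measurability

variable {Ω : Type u} {ξ : Site → ℝ≥0 → Ω → ℤˣ}

lemma stableValue_mem (a k : ℕ) (h s : ℝ≥0) (ω : Ω) :
    stableValue ξ a k h s ω ∈ Set.Icc (0 : ℝ) 1 := by
  by_cases hω : ω ∈ stripStable ξ a k h s
  · rw [stableValue, Set.indicator_of_mem hω]; exact stripValue_mem _ _ _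
  · rw [stableValue, Set.indicator_of_notMem hω]; simp

lemma stableValue_le (a k : ℕ) (h s : ℝ≥0) (ω : Ω) :
    stableValue ξ a k h s ω ≤ stripValue a k (fun w => ξ w s ω) :=
  Set.indicator_le_self' (fun _ _ => (stripValue_mem _ _ _).1) ω

/-- The rows of the `k`-th strip. -/
def stripRows (a k : ℕ) : Set ℤ := Set.Ico (stripRow a k : ℤ) (stripRow a (k + 1))

lemma measurable_stripValue_rows (a k : ℕ) (s : ℝ≥0) :
    Measurable[rowAlgebra ξ (stripRows a k)] (fun ω => stripValue a k (fun w => ξ w s ω)) := by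
  rw [stripRows, stripRow_succ, Nat.cast_add]
  exact measurable_minValue _ _ (stripStart a k) _ _

lemma measurableSet_flipsIn {J : Set ℤ} {z : Site} (hz : z.1.2 ∈ J) (s l : ℝ≥0) :
    MeasurableSet[rowAlgebra ξ J] (flipsIn (ξ z) s l) := by
  refine MeasurableSet.iUnion fun m => MeasurableSet.biUnion (Set.to_countable _) fun j _ => ?_
  have : {ω | ξ z (dyadicPoint s l m j) ω ≠ ξ z (dyadicPoint s l m (j + 1)) ω} =
      ⋃ b : ℤˣ, {ω | ξ z (dyadicPoint s l m j) ω = b} ∩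
        {ω | ξ z (dyadicPoint s l m (j + 1)) ω = b}ᶜ := by
    ext ω
    simp [eq_comm]
  rw [this]
  exact MeasurableSet.iUnion fun b =>
    (measurableSet_arrow hz _ b).inter (measurableSet_arrow hz _ b).compl

lemma measurableSet_stripStable (a k : ℕ) (h s : ℝ≥0) :
    MeasurableSet[rowAlgebra ξ (stripRows a k)] (stripStable ξ a k h s) := by
  refine Finset.measurableSet_biInter _ fun z hz => (measurableSet_flipsIn ?_ _ _).compl
  have := reach_row hz
  rw [stripRows, stripRow_succ, Nat.cast_add]
  exact this

lemma measurable_stableValue (a k : ℕ) (h s : ℝ≥0) :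
    Measurable[rowAlgebra ξ (stripRows a k)] (stableValue ξ a k h s) :=
  Measurable.indicator (measurable_stripValue_rows a k s) (measurableSet_stripStable a k h s)

lemma measurable_prod_strips {a : ℕ} {g : ℕ → Ω → ℝ}
    (hg : ∀ k, Measurable[rowAlgebra ξ (stripRows a k)] (g k)) (n : ℕ) :
    Measurable[rowAlgebra ξ (Set.Iio (stripRow a n : ℤ))]
      (fun ω => ∏ k ∈ Finset.range n, g k ω) := by
  have hmono : Monotone (stripRow a) := monotone_nat_of_le_succ fun k => by
    rw [stripRow_succ]; exact Nat.le_add_right _ _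
  refine Finset.measurable_fun_prod _ fun k hk => (hg k).mono (rowAlgebra_mono ?_) le_rfl
  intro i hi
  have : stripRow a (k + 1) ≤ stripRow a n := hmono (Finset.mem_range.1 hk)
  exact lt_of_lt_of_le hi.2 (by exact_mod_cast this)

lemma IsDynamicalWeb.measurable_stableValue_ambient [MeasurableSpace Ω] {P : Measure Ω}
    {lam : ℝ} (hξ : IsDynamicalWeb P lam ξ) (a k : ℕ) (h s : ℝ≥0) :
    Measurable (stableValue ξ a k h s) :=
  (measurable_stableValue a k h s).mono (hξ.rowAlgebra_le _) le_rfl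

/-- The product of the values of the first `n` strips. -/
noncomputable def prefixValue {Ω : Type u} (ξ : Site → ℝ≥0 → Ω → ℤˣ) (a : ℕ) (h : ℕ → ℝ≥0) (n : ℕ)
    (s : ℝ≥0) (ω : Ω) : ℝ := ∏ k ∈ Finset.range n, stableValue ξ a k (h k) s ω

lemma prefixValue_mem (a : ℕ) (h : ℕ → ℝ≥0) (n : ℕ)
    (s : ℝ≥0) (ω : Ω) : prefixValue ξ a h n s ω ∈ Set.Icc (0 : ℝ) 1 :=
  ⟨Finset.prod_nonneg fun _ _ => (stableValue_mem _ _ _ _ _).1,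
    Finset.prod_le_one (fun _ _ => (stableValue_mem _ _ _ _ _).1)
      fun _ _ => (stableValue_mem _ _ _ _ _).2⟩

lemma IsDynamicalWeb.measurable_prefixValue [MeasurableSpace Ω] {P : Measure Ω}
    {lam : ℝ} (hξ : IsDynamicalWeb P lam ξ) (a : ℕ) (h : ℕ → ℝ≥0)
    (n : ℕ) (s : ℝ≥0) : Measurable (prefixValue ξ a h n s) :=
  Finset.measurable_fun_prod _ fun _ _ => hξ.measurable_stableValue_ambient _ _ _ _

end measurability

section secondMoment

variable {Ω : Type u} [MeasurableSpace Ω] {P : Measure Ω} [IsProbabilityMeasure P] {lam : ℝ}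
  {ξ : Site → ℝ≥0 → Ω → ℤˣ}

lemma IsDynamicalWeb.integral_prod_strips (hξ : IsDynamicalWeb P lam ξ) {a : ℕ} {g : ℕ → Ω → ℝ}
    (hg : ∀ k, Measurable[rowAlgebra ξ (stripRows a k)] (g k)) (n : ℕ) :
    ∫ ω, ∏ k ∈ Finset.range n, g k ω ∂P = ∏ k ∈ Finset.range n, ∫ ω, g k ω ∂P := by
  induction n with
  | zero => simp
  | succ n ih =>
    simp only [Finset.prod_range_succ]
    rw [integral_mul_of_indep (hξ.rowAlgebra_le _) (hξ.rowAlgebra_le _)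
      (hξ.indep_rowAlgebra (J := Set.Iio (stripRow a n : ℤ)) (J' := stripRows a n) ?_)
      (measurable_prod_strips hg n) (hg n), ih]
    exact Set.disjoint_left.2 fun i hi hi' => not_lt.2 hi'.1 hi

lemma IsDynamicalWeb.real_compl_stripStable_le (hξ : IsDynamicalWeb P lam ξ) (hlam : 0 ≤ lam)
    (a k : ℕ) (h s : ℝ≥0) : P.real (stripStable ξ a k h s)ᶜ ≤
      (reach (stripLen a k) (stripStart a k)).card * (lam * h) := by
  rw [stripStable, Set.compl_iInter₂]
  simp only [compl_compl]
  refine (measureReal_biUnion_finset_le _ _).trans ?_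
  rw [← nsmul_eq_mul]
  refine Finset.sum_le_card_nsmul _ _ _ fun z _ => ?_
  have := (hξ.flip z).real_flipsIn_le (hξ.initial z) (s - h) (2 * h)
  have h2 := ENNReal.toReal_le_of_le_ofReal (by positivity) this
  refine h2.trans_eq ?_
  push_cast; ring

lemma IsDynamicalWeb.le_integral_stableValue (hξ : IsDynamicalWeb P lam ξ) (hlam : 0 ≤ lam)
    {a : ℕ} (ha : 1 ≤ a) (k : ℕ) {h : ℝ≥0}
    (hh : (reach (stripLen a k) (stripStart a k)).card * (lam * h) ≤ 3 / 4 * (1 / 2) ^ (k + 2))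
    (s : ℝ≥0) :
    stripMean a k * (1 - (1 / 2) ^ (k + 2)) ≤ ∫ ω, stableValue ξ a k h s ω ∂P := by
  have hms := hξ.rowAlgebra_le _ _ (measurableSet_stripStable (ξ := ξ) a k h s)
  have h1 : ∫ ω, stripValue a k (fun w => ξ w s ω) ∂P ≤
      ∫ ω, (stableValue ξ a k h s ω + (stripStable ξ a k h s)ᶜ.indicator (fun _ => (1 : ℝ)) ω) ∂P := by
    refine integral_mono (integrable_of_mem_Icc (hξ.measurable_stripValue _ _ _)
      fun _ => stripValue_mem _ _ _) ((integrable_of_mem_Icc (hξ.measurable_stableValue_ambient _ _ _ _)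
      (stableValue_mem _ _ _ _)).add ((integrable_const _).indicator hms.compl)) fun ω => ?_
    by_cases hω : ω ∈ stripStable ξ a k h s
    · simp [stableValue, hω]
    · simpa [stableValue, hω] using (stripValue_mem _ _ _).2
  rw [integral_add (integrable_of_mem_Icc (hξ.measurable_stableValue_ambient _ _ _ _)
      (stableValue_mem _ _ _ _)) ((integrable_const _).indicator hms.compl),
    hξ.integral_stripValue, integral_indicator_const _ hms.compl] at h1
  have h2 := hξ.real_compl_stripStable_le hlam a k h s
  have h3 := le_stripMean ha k
  have h4 : 3 / 4 * (1 / 2 : ℝ) ^ (k + 2) ≤ stripMean a k * (1 / 2) ^ (k + 2) := by gcongr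
  simp only [smul_eq_mul, mul_one] at h1
  linarith

lemma IsDynamicalWeb.le_integral_prefixValue (hξ : IsDynamicalWeb P lam ξ) (hlam : 0 ≤ lam)
    {a : ℕ} (ha : 1 ≤ a) {h : ℕ → ℝ≥0}
    (hh : ∀ k, (reach (stripLen a k) (stripStart a k)).card * (lam * h k) ≤
      3 / 4 * (1 / 2) ^ (k + 2)) (n : ℕ) (s : ℝ≥0) :
    (∏ k ∈ Finset.range n, stripMean a k) / 2 ≤ ∫ ω, prefixValue ξ a h n s ω ∂P := by
  have hp : 0 ≤ ∏ k ∈ Finset.range n, stripMean a k :=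
    Finset.prod_nonneg fun k _ => le_trans (by norm_num) (le_stripMean ha k)
  simp only [prefixValue]
  rw [hξ.integral_prod_strips (fun k => measurable_stableValue a k (h k) s)]
  calc (∏ k ∈ Finset.range n, stripMean a k) / 2
      ≤ (∏ k ∈ Finset.range n, stripMean a k) *
          ∏ k ∈ Finset.range n, (1 - (1 / 2 : ℝ) ^ (k + 2)) := by
        rw [div_eq_mul_inv]
        refine mul_le_mul_of_nonneg_left ?_ hp
        refine le_trans ?_ (half_le_prod n)
        have : (0 : ℝ) < (1 / 2) ^ (n + 1) := by positivity
        linarith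
    _ = ∏ k ∈ Finset.range n, stripMean a k * (1 - (1 / 2) ^ (k + 2)) :=
        Finset.prod_mul_distrib.symm
    _ ≤ _ := Finset.prod_le_prod (fun k _ => mul_nonneg
          (le_trans (by norm_num) (le_stripMean ha k))
          (sub_nonneg.2 (pow_le_one₀ (by norm_num) (by norm_num))))
        fun k _ => hξ.le_integral_stableValue hlam ha k (hh k) s

lemma IsDynamicalWeb.integral_prefixValue_mul_le (hξ : IsDynamicalWeb P lam ξ) {a : ℕ}
    {h : ℕ → ℝ≥0} {s s' : ℝ≥0} {C : ℕ → ℝ} (hC : ∀ k, ∫ ω, stripValue a k (fun w => ξ w s ω) *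
      stripValue a k (fun w => ξ w s' ω) ∂P ≤ stripMean a k ^ 2 * C k) (n : ℕ) :
    ∫ ω, prefixValue ξ a h n s ω * prefixValue ξ a h n s' ω ∂P ≤
      (∏ k ∈ Finset.range n, stripMean a k) ^ 2 * ∏ k ∈ Finset.range n, C k := by
  have hmeas : ∀ k, Measurable[rowAlgebra ξ (stripRows a k)] fun ω =>
      stripValue a k (fun w => ξ w s ω) * stripValue a k (fun w => ξ w s' ω) := fun k =>
    (measurable_stripValue_rows a k s).mul (measurable_stripValue_rows a k s')
  have hmem : ∀ ω, ∏ k ∈ Finset.range n, (stripValue a k (fun w => ξ w s ω) *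
      stripValue a k (fun w => ξ w s' ω)) ∈ Set.Icc (0 : ℝ) 1 := fun ω =>
    ⟨Finset.prod_nonneg fun k _ => (mul_mem_Icc (stripValue_mem _ _ _) (stripValue_mem _ _ _)).1,
      Finset.prod_le_one (fun k _ => (mul_mem_Icc (stripValue_mem _ _ _) (stripValue_mem _ _ _)).1)
        fun k _ => (mul_mem_Icc (stripValue_mem _ _ _) (stripValue_mem _ _ _)).2⟩
  calc ∫ ω, prefixValue ξ a h n s ω * prefixValue ξ a h n s' ω ∂P
      ≤ ∫ ω, ∏ k ∈ Finset.range n, (stripValue a k (fun w => ξ w s ω) *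
          stripValue a k (fun w => ξ w s' ω)) ∂P := by
        refine integral_mono (integrable_of_mem_Icc ((hξ.measurable_prefixValue _ _ _ _).mul
          (hξ.measurable_prefixValue _ _ _ _)) fun _ => mul_mem_Icc (prefixValue_mem _ _ _ _ _)
          (prefixValue_mem _ _ _ _ _)) (integrable_of_mem_Icc
          ((measurable_prod_strips hmeas n).mono (hξ.rowAlgebra_le _) le_rfl) hmem) fun ω => ?_
        simp only [prefixValue]
        rw [← Finset.prod_mul_distrib]
        refine Finset.prod_le_prod (fun k _ => (mul_mem_Icc (stableValue_mem _ _ _ _ _)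
          (stableValue_mem _ _ _ _ _)).1) fun k _ => ?_
        exact mul_le_mul (stableValue_le _ _ _ _ _) (stableValue_le _ _ _ _ _)
          (stableValue_mem _ _ _ _ _).1 (stripValue_mem _ _ _).1
    _ = ∏ k ∈ Finset.range n, ∫ ω, stripValue a k (fun w => ξ w s ω) *
          stripValue a k (fun w => ξ w s' ω) ∂P := hξ.integral_prod_strips hmeas n
    _ ≤ ∏ k ∈ Finset.range n, stripMean a k ^ 2 * C k :=
        Finset.prod_le_prod (fun k _ => integral_nonneg fun ω =>
          (mul_mem_Icc (stripValue_mem _ _ _) (stripValue_mem _ _ _)).1) fun k _ => hC k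
    _ = _ := by rw [Finset.prod_mul_distrib, Finset.prod_pow]

/-- The second moment method. -/
lemma le_real_pos_of_second_moment {X : Ω → ℝ} (hX : Measurable X) (hX0 : ∀ ω, 0 ≤ X ω)
    (hi : Integrable X P) (hi2 : Integrable (fun ω => X ω * X ω) P) {v M : ℝ} (hv : 0 < v)
    (hM : 0 < M) (h1 : v / 2 ≤ ∫ ω, X ω ∂P) (h2 : ∫ ω, X ω * X ω ∂P ≤ M * v ^ 2) :
    1 / (4 * M) ≤ P.real {ω | 0 < X ω} := by
  have hms : MeasurableSet {ω | 0 < X ω} := measurableSet_lt measurable_const hX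
  have hpt : ∀ ω, X ω ≤ 1 / (4 * M * v) * (X ω * X ω) +
      M * v * {ω | 0 < X ω}.indicator (fun _ => (1 : ℝ)) ω := by
    intro ω
    by_cases h : ω ∈ {ω | 0 < X ω}
    · rw [Set.indicator_of_mem h]
      have : 1 / (4 * M * v) * (X ω * X ω) + M * v * 1 - X ω =
          (X ω - 2 * M * v) ^ 2 / (4 * M * v) := by field_simp; ring
      rw [← sub_nonneg, this]; positivity
    · rw [Set.indicator_of_notMem h, le_antisymm (not_lt.1 h) (hX0 ω)]; simp
  have h3 := integral_mono hi ((hi2.const_mul _).add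
    (((integrable_const (1 : ℝ)).indicator hms).const_mul (M * v))) hpt
  simp only [Pi.add_apply] at h3
  rw [integral_add (hi2.const_mul _) (((integrable_const (1 : ℝ)).indicator hms).const_mul _),
    integral_const_mul, integral_const_mul, integral_indicator_const _ hms] at h3
  simp only [smul_eq_mul, mul_one] at h3
  have h4 : 1 / (4 * M * v) * ∫ ω, X ω * X ω ∂P ≤ v / 4 := by
    calc 1 / (4 * M * v) * ∫ ω, X ω * X ω ∂P ≤ 1 / (4 * M * v) * (M * v ^ 2) := by gcongr
      _ = v / 4 := by field_simp
  have h5 : v * (1 / 4) ≤ v * (M * P.real {ω | 0 < X ω}) := by linarith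
  have h6 := le_of_mul_le_mul_left h5 hv
  rw [div_le_iff₀ (by positivity)]
  linarith

/-- With probability bounded below, there is a dynamical time at which the first `n` strips are
good. -/
lemma IsDynamicalWeb.le_real_exists_prefixValue_pos (hξ : IsDynamicalWeb P lam ξ) (hlam : 0 < lam)
    {a : ℕ} (ha : 1 ≤ a) {κ : ℝ} (hκ : 0 < κ) (hκa : κ ≤ a * lam) {h : ℕ → ℝ≥0}
    (hh : ∀ k, (reach (stripLen a k) (stripStart a k)).card * (lam * h k) ≤
      3 / 4 * (1 / 2) ^ (k + 2)) (n : ℕ) :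
    ∃ E : Set Ω, MeasurableSet E ∧ 1 / (4 * (17 + 64 / √κ)) ≤ P.real E ∧
      ∀ ω ∈ E, ∃ s ∈ Set.Icc (0 : ℝ≥0) 1, 0 < prefixValue ξ a h n s ω := by
  obtain ⟨N, hN⟩ := exists_nat_ge ((4 / 3 : ℝ) ^ n)
  have hN0 : (0 : ℝ) < N := lt_of_lt_of_le (by positivity) hN
  set Q := ∏ k ∈ Finset.range n, stripMean a k with hQ
  have hQ0 : 0 < Q := Finset.prod_pos fun k _ => lt_of_lt_of_le (by norm_num) (le_stripMean ha k)
  let t : ℕ → ℝ≥0 := fun i => i / N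
  let X : Ω → ℝ := fun ω => ∑ i ∈ Finset.range N, prefixValue ξ a h n (t i) ω
  have hXm : Measurable X :=
    Finset.measurable_fun_sum _ fun i _ => hξ.measurable_prefixValue a h n (t i)
  have hint : ∀ i, Integrable (prefixValue ξ a h n (t i)) P := fun i =>
    integrable_of_mem_Icc (hξ.measurable_prefixValue _ _ _ _) (prefixValue_mem _ _ _ _)
  have hint2 : ∀ i j, Integrable (fun ω => prefixValue ξ a h n (t i) ω *
      prefixValue ξ a h n (t j) ω) P := fun i j =>
    integrable_of_mem_Icc ((hξ.measurable_prefixValue _ _ _ _).mul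
      (hξ.measurable_prefixValue _ _ _ _)) fun _ => mul_mem_Icc (prefixValue_mem _ _ _ _ _)
      (prefixValue_mem _ _ _ _ _)
  have hXX : ∀ ω, X ω * X ω = ∑ i ∈ Finset.range N, ∑ j ∈ Finset.range N,
      prefixValue ξ a h n (t i) ω * prefixValue ξ a h n (t j) ω := fun ω =>
    Finset.sum_mul_sum _ _ _ _
  refine ⟨{ω | 0 < X ω}, measurableSet_lt measurable_const hXm,
    le_real_pos_of_second_moment hXm
      (fun ω => Finset.sum_nonneg fun i _ => (prefixValue_mem _ _ _ _ _).1)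
      (integrable_finsetSum _ fun i _ => hint i) ?_ (v := N * Q) (by positivity)
      (by positivity) ?_ ?_, ?_⟩
  · simp only [hXX]
    exact integrable_finsetSum _ fun i _ => integrable_finsetSum _ fun j _ => hint2 i j
  · rw [integral_finsetSum _ fun i _ => hint i]
    have := Finset.card_nsmul_le_sum (Finset.range N)
      (fun i => ∫ ω, prefixValue ξ a h n (t i) ω ∂P) (Q / 2)
      fun i _ => hξ.le_integral_prefixValue hlam.le ha hh n (t i)
    rw [Finset.card_range, nsmul_eq_mul] at this
    linarith
  · simp only [hXX]
    rw [integral_finsetSum _ fun i _ => integrable_finsetSum _ fun j _ => hint2 i j]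
    have hpair : ∀ i j : ℕ, ∫ ω, prefixValue ξ a h n (t i) ω * prefixValue ξ a h n (t j) ω ∂P ≤
        Q ^ 2 * ((if i = j then (N : ℝ) else 0) + 16 + 16 * √(N / κ) * (1 / √|(i : ℝ) - j|)) := by
      intro i j
      by_cases hij : i = j
      · subst hij
        refine (hξ.integral_prefixValue_mul_le
          (fun k => hξ.integral_stripValue_sq_le ha k (t i)) n).trans ?_
        rw [Finset.prod_const, Finset.card_range]
        refine mul_le_mul_of_nonneg_left ?_ (sq_nonneg _)
        simp; linarith
      · have htij : t i ≠ t j := by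
          simp only [t, ne_eq]
          rw [div_left_inj' (by exact_mod_cast hN0.ne')]
          exact_mod_cast hij
        refine (hξ.integral_prefixValue_mul_le
          (fun k => hξ.integral_stripValue_mul_le hlam ha hκ hκa k htij) n).trans ?_
        refine mul_le_mul_of_nonneg_left ?_ (sq_nonneg _)
        have habs : 0 < |(i : ℝ) - j| := abs_pos.2 (sub_ne_zero.2 (by exact_mod_cast hij))
        have e : κ * |((t i : ℝ≥0) : ℝ) - t j| = |(i : ℝ) - j| / (N / κ) := by
          simp only [t]; push_cast
          rw [← sub_div, abs_div, abs_of_pos hN0]; field_simp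
        rw [e]
        refine (prod_corrBound_le n (by positivity)).trans_eq ?_
        rw [if_neg hij, Real.sqrt_div' _ (by positivity)]
        rw [one_div_div]
        ring
    calc ∑ i ∈ Finset.range N, ∫ ω, ∑ j ∈ Finset.range N,
          prefixValue ξ a h n (t i) ω * prefixValue ξ a h n (t j) ω ∂P
        ≤ ∑ i ∈ Finset.range N, Q ^ 2 * (N * (17 + 64 / √κ)) := by
          refine Finset.sum_le_sum fun i hi => ?_
          rw [integral_finsetSum _ fun j _ => hint2 i j]
          refine (Finset.sum_le_sum fun j _ => hpair i j).trans ?_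
          rw [← Finset.mul_sum]
          refine mul_le_mul_of_nonneg_left ?_ (sq_nonneg _)
          rw [Finset.sum_add_distrib, Finset.sum_add_distrib, ← Finset.mul_sum,
            Finset.sum_ite_eq, if_pos hi, Finset.sum_const, Finset.card_range, nsmul_eq_mul]
          have h1 := mul_le_mul_of_nonneg_left (sum_range_one_div_sqrt_le (Finset.mem_range.1 hi))
            (show 0 ≤ 16 * √(N / κ) by positivity)
          have h2 : 16 * √(N / κ) * (4 * √N) = N * (64 / √κ) := by
            rw [Real.sqrt_div' _ hκ.le]
            have := Real.mul_self_sqrt hN0.le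
            calc 16 * (√(N : ℝ) / √κ) * (4 * √N) = (√(N : ℝ) * √N) * (64 / √κ) := by ring
              _ = _ := by rw [this]
          linarith
      _ = (17 + 64 / √κ) * (N * Q) ^ 2 := by
          rw [Finset.sum_const, Finset.card_range, nsmul_eq_mul]; ring
  · intro ω hω
    obtain ⟨i, hi, hpos⟩ := Finset.exists_lt_of_sum_lt (s := Finset.range N)
      (f := fun _ => (0 : ℝ)) (g := fun i => prefixValue ξ a h n (t i) ω) (by simpa using hω)
    refine ⟨t i, ⟨zero_le, ?_⟩, hpos⟩
    simp only [t]
    rw [div_le_one (by exact_mod_cast hN0)]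
    exact_mod_cast (Finset.mem_range.1 hi).le

end secondMoment

section exceptional

variable {Ω : Type u} [MeasurableSpace Ω] {P : Measure Ω} {lam : ℝ} {ξ : Site → ℝ≥0 → Ω → ℤˣ}

/-- A strip that is good at `s` and stable around `s` is good at all dynamical times near `s`. -/
lemma IsDynamicalWeb.stripValue_pos_of_near (hξ : IsDynamicalWeb P lam ξ) {a k : ℕ}
    {h s s' : ℝ≥0} {ω : Ω} (hpos : 0 < stableValue ξ a k h s ω) (h1 : s < s' + h)
    (h2 : s' < s + h) : 0 < stripValue a k (fun w => ξ w s' ω) := by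
  have hω : ω ∈ stripStable ξ a k h s := by
    by_contra hω
    rw [stableValue, Set.indicator_of_notMem hω] at hpos
    exact hpos.false
  rw [stableValue, Set.indicator_of_mem hω] at hpos
  have hh : 0 < h := by
    by_contra! hh
    rw [nonpos_iff_eq_zero.1 hh, add_zero] at h1 h2
    exact lt_asymm h1 h2
  have hsh : s + h ≤ s - h + 2 * h := by
    rw [two_mul, ← add_assoc]; gcongr; exact le_tsub_add
  refine hpos.trans_eq (minValue_congr _ fun w hw => ?_)
  have hst : ω ∉ flipsIn (ξ w) (s - h) (2 * h) := Set.mem_iInter₂.1 hω w hw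
  rw [(hξ.flip w).eq_of_notMem_flipsIn hst tsub_le_self ((lt_add_of_pos_right s hh).trans_le hsh),
    (hξ.flip w).eq_of_notMem_flipsIn hst (tsub_le_iff_right.2 h1.le) (h2.trans_le hsh)]

/-- Compactness of the set of dynamical times. -/
lemma IsDynamicalWeb.exists_forall_stripValue_pos (hξ : IsDynamicalWeb P lam ξ) {a : ℕ}
    {h : ℕ → ℝ≥0} (hh : ∀ k, 0 < h k) {ω : Ω}
    (hω : ∀ m, ∃ n ≥ m, ∃ s ∈ Set.Icc (0 : ℝ≥0) 1, 0 < prefixValue ξ a h n s ω) :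
    ∃ s ∈ Set.Icc (0 : ℝ≥0) 1, ∀ k, 0 < stripValue a k (fun w => ξ w s ω) := by
  choose n hn s hs hpos using hω
  obtain ⟨s', hs', f, hf, hlim⟩ := isCompact_Icc.tendsto_subseq hs
  refine ⟨s', hs', fun k => ?_⟩
  have hball : ∀ᶠ m in atTop, dist (s (f m)) s' < h k :=
    hlim.eventually (Metric.ball_mem_nhds s' (NNReal.coe_pos.2 (hh k)))
  obtain ⟨m, hm, hkm⟩ := (hball.and (eventually_gt_atTop k)).exists
  have hk : k ∈ Finset.range (n (f m)) :=
    Finset.mem_range.2 (hkm.trans_le ((hf.id_le m).trans (hn _)))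
  have hne := Finset.prod_ne_zero_iff.1 (hpos (f m)).ne' k hk
  rw [NNReal.dist_eq, abs_lt] at hm
  refine hξ.stripValue_pos_of_near (lt_of_le_of_ne (stableValue_mem _ _ _ _ _).1 hne.symm) ?_ ?_
  · rw [← NNReal.coe_lt_coe]; push_cast; linarith
  · rw [← NNReal.coe_lt_coe]; push_cast; linarith

/-- The probability that all strips are good at some dynamical time in `[0, 1]` is bounded below in
terms of the product of the spatial scale and the switching rate. -/
lemma IsDynamicalWeb.le_measure_exists_stripValue_pos [IsProbabilityMeasure P]
    (hξ : IsDynamicalWeb P lam ξ) (hlam : 0 < lam) {a : ℕ} (ha : 1 ≤ a) {κ : ℝ} (hκ : 0 < κ)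
    (hκa : κ ≤ a * lam) :
    ENNReal.ofReal (1 / (4 * (17 + 64 / √κ))) ≤
      P {ω | ∃ s ∈ Set.Icc (0 : ℝ≥0) 1, ∀ k, 0 < stripValue a k (fun w => ξ w s ω)} := by
  have hex : ∀ k, ∃ h : ℝ≥0, 0 < h ∧ (reach (stripLen a k) (stripStart a k)).card * (lam * h) ≤
      3 / 4 * (1 / 2) ^ (k + 2) := by
    intro k
    set c : ℝ := ((reach (stripLen a k) (stripStart a k)).card : ℝ)
    have hc : 0 ≤ c := Nat.cast_nonneg _
    have hpos : 0 < 3 / 4 * (1 / 2 : ℝ) ^ (k + 2) / ((c + 1) * lam) := by positivity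
    refine ⟨Real.toNNReal _, Real.toNNReal_pos.2 hpos, ?_⟩
    rw [Real.coe_toNNReal _ hpos.le]
    have e : c * (lam * (3 / 4 * (1 / 2 : ℝ) ^ (k + 2) / ((c + 1) * lam))) =
        3 / 4 * (1 / 2 : ℝ) ^ (k + 2) * (c / (c + 1)) := by field_simp
    rw [e]
    exact mul_le_of_le_one_right (by positivity) ((div_le_one (by positivity)).2 (by linarith))
  choose h hh hhk using hex
  choose E hE hEP hEω using hξ.le_real_exists_prefixValue_pos hlam ha hκ hκa hhk
  have hanti : Antitone fun m => ⋃ n ≥ m, E n := fun m m' hm =>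
    Set.biUnion_subset_biUnion_left fun n hn => le_trans hm hn
  have hlim : ENNReal.ofReal (1 / (4 * (17 + 64 / √κ))) ≤ P (⋂ m, ⋃ n ≥ m, E n) := by
    rw [hanti.measure_iInter (fun m => (MeasurableSet.biUnion (Set.to_countable _)
      fun n _ => hE n).nullMeasurableSet) ⟨0, measure_ne_top _ _⟩]
    refine le_iInf fun m => ?_
    calc ENNReal.ofReal (1 / (4 * (17 + 64 / √κ))) ≤ P (E m) := by
          rw [← ofReal_measureReal (measure_ne_top _ _)]
          exact ENNReal.ofReal_le_ofReal (hEP m)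
      _ ≤ _ := measure_mono (Set.subset_biUnion_of_mem (u := E) (le_refl m))
  refine hlim.trans (measure_mono fun ω hω => hξ.exists_forall_stripValue_pos hh fun m => ?_)
  obtain ⟨n, hn, hωn⟩ := Set.mem_iUnion₂.1 (Set.mem_iInter.1 hω m)
  exact ⟨n, hn, hEω n ω hωn⟩

lemma IsDynamicalWeb.le_exceptionalProb [IsProbabilityMeasure P]
    (hξ : IsDynamicalWeb P lam ξ) (hlam : 0 < lam) {a : ℕ} (ha : 1 ≤ a) {κ : ℝ} (hκ : 0 < κ)
    (hκa : κ ≤ a * lam) {δ k : ℝ} (hδ : 0 < δ) (hk : 0 ≤ k) (hak : a = 1 ∨ 8 * a ≤ k / √δ) :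
    ENNReal.ofReal (1 / (4 * (17 + 64 / √κ))) ≤ exceptionalProb P ξ δ 16 k := by
  refine (hξ.le_measure_exists_stripValue_pos hlam ha hκ hκa).trans (measure_mono ?_)
  rintro ω ⟨s, hs, hpos⟩
  refine ⟨s, hs, fun t ht => ?_⟩
  have hδ' : 0 < √δ := Real.sqrt_pos.2 hδ
  have hb := barrier_le_walk ha hpos (div_nonneg hk hδ'.le) hak ⌊t / δ⌋₊
  have hsqrt : √δ * √(⌊t / δ⌋₊ : ℝ) ≤ √t := by
    rw [← Real.sqrt_mul hδ.le]
    refine Real.sqrt_le_sqrt ?_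
    have := Nat.floor_le (div_nonneg ht hδ.le)
    rwa [le_div_iff₀ hδ, mul_comm] at this
  have h1 := mul_le_mul_of_nonneg_left hb hδ'.le
  have h2 : √δ * (-(k / √δ) - 16 * √(⌊t / δ⌋₊ : ℝ)) = -k - 16 * (√δ * √(⌊t / δ⌋₊ : ℝ)) := by
    field_simp
  rw [h2] at h1
  simp only [rescaledPath, pathAt]
  linarith

end exceptional

/-- For the barrier constant `16`, uniform positivity holds for all parameters. -/
lemma uniformlyPositive {k lbar0 : ℝ} (hk : 0 < k) (hl : 0 < lbar0) (lam0 : ℝ) :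
    UniformlyPositive.{u} 16 k lbar0 lam0 := by
  refine ⟨ENNReal.ofReal (1 / (4 * (17 + 64 / √(k * lbar0 / 16)))),
    ENNReal.ofReal_pos.2 (by positivity), ?_⟩
  intro lbar δ hlbar hδ _ Ω _ P _ ξ hξ
  have hδ' : 0 < √δ := Real.sqrt_pos.2 hδ
  have hlbar0 : 0 < lbar := hl.trans_le hlbar
  set x := k / (8 * √δ) with hx
  have hx0 : 0 < x := by positivity
  have hk' : k = 8 * √δ * x := by rw [hx]; field_simp
  refine hξ.le_exceptionalProb (by positivity) (a := max 1 ⌊x⌋₊) (le_max_left _ _)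
    (by positivity) ?_ hδ hk.le ?_
  · have h1 : x ≤ 2 * ((max 1 ⌊x⌋₊ : ℕ) : ℝ) := by
      have h2 := (Nat.lt_floor_add_one x).le
      have h3 : ((⌊x⌋₊ : ℕ) : ℝ) ≤ ((max 1 ⌊x⌋₊ : ℕ) : ℝ) := by exact_mod_cast le_max_right _ _
      have h4 : (1 : ℝ) ≤ ((max 1 ⌊x⌋₊ : ℕ) : ℝ) := by exact_mod_cast le_max_left _ _
      linarith
    calc k * lbar0 / 16 ≤ k * lbar / 16 := by gcongr
      _ = x / 2 * (lbar * √δ) := by rw [hk']; ring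
      _ ≤ _ := by gcongr; linarith
  · rcases le_total ⌊x⌋₊ 1 with h | h
    · exact .inl (max_eq_left h)
    · right
      rw [max_eq_right h, hk']
      have := Nat.floor_le hx0.le
      rw [le_div_iff₀ hδ']
      nlinarith

end DynWeb

theorem theorem2 :
    ∃ K : ℝ, 0 < K ∧
      (∀ k : ℝ, 0 < k → ∃ lbar0 lam0 : ℝ, 0 < lbar0 ∧ 0 < lam0 ∧
        DynWeb.UniformlyPositive.{u} K k lbar0 lam0) ∧
      (∀ lbar0 lam0 : ℝ, 0 < lbar0 → 0 < lam0 → ∃ k : ℝ, 0 < k ∧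
        DynWeb.UniformlyPositive.{u} K k lbar0 lam0) ∧
      (∀ δ lbar : ℝ, 0 < δ → 0 < lbar →
        ∀ (Ω : Type u) [MeasurableSpace Ω] (P : Measure Ω) [IsProbabilityMeasure P]
          (ξ : DynWeb.Site → ℝ≥0 → Ω → ℤˣ),
          DynWeb.IsDynamicalWeb P (lbar * √δ) ξ → 0 < DynWeb.exceptionalProb P ξ δ K 0) := by
  refine ⟨16, by norm_num, fun k hk => ⟨1, 1, one_pos, one_pos,
    DynWeb.uniformlyPositive hk one_pos 1⟩, fun lbar0 lam0 h _ => ⟨1, one_pos,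
    DynWeb.uniformlyPositive one_pos h lam0⟩, ?_⟩
  intro δ lbar hδ hl Ω _ P _ ξ hξ
  have hlam : 0 < lbar * √δ := mul_pos hl (Real.sqrt_pos.2 hδ)
  exact (ENNReal.ofReal_pos.2 (by positivity)).trans_le
    (hξ.le_exceptionalProb hlam le_rfl hlam (by simp) hδ le_rfl (.inl rfl))
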